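/- All graphs are finite and simple and are considered up to isomorphism. For integers $l\ge 4$ and $l_1,l_2\ge 3$, the (two-eared) dog $D(l,l_1,l_2)$ is the graph obtained from a cycle $C_l$ (the snout), four consecutive vertices $v_1,v_2,v_3,v_4$ of it, and two further disjoint cycles $C_{l_1}$ and $C_{l_2}$ (the ears), by identifying the edge $v_1v_2$ with an edge of $C_{l_1}$ and the edge $v_3v_4$ with an edge of $C_{l_2}$. For a set $U$ of vertices of a graph $G$, the contraction $G/U$ is obtained from $G$ by removing the vertices in $U$ and adding a new vertex adjacent to every vertex outside $U$ that has a neighbour in $U$. Contracting an edge $uv$ means forming $G/\{u,v\}$. For two distinct vertices $u,v$ of $G$ (adjacent or not), forming $G/\{u,v\}$ is an admissible contraction if $u$ and $v$ have a common neighbour $w$ such that the path $u,w,v$ is part of a cycle $C$ of $G$ that is induced (has no chord in $G$) and non-separating ($G-V(C)$ has no more connected components than $G$). A graph $H$ is a minor of $G$ if $H$ can be obtained from $G$ by a finite (possibly empty) sequence of vertex deletions, edge deletions and edge contractions; $H$ is a bipartite minor of $G$ if $H$ can be obtained from $G$ by a finite (possibly empty) sequence of vertex deletions, edge deletions and admissible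 contractions. **Theorem.** For all integers $l\ge 5$, $l_1,l_2\ge 3$ and $k\ge 1$, the dog $D(l,l_1,l_2)$ is a minor, but not a bipartite minor, of the dog $D(l+k,l_1,l_2)$. -/

import Mathlib

namespace BipartiteMinors

universe u

variable {V W : Type u}

/-! ### Dogs -/

/-- The graph obtained from `G` by gluing on a cycle of length `m` (an ear, `3 ≤ m`), one edge of
which is identified with the edge `xy` of `G`.  The vertices of the glued cycle are `x`, the `m - 2`
new vertices `inr 0, …, inr (m - 3)`, and `y`, in this cyclic order; the edge of the cycle
between `y` and `x` is the edge `xy` of `G`. -/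
def attachEar (G : SimpleGraph V) (x y : V) (m : ℕ) : SimpleGraph (V ⊕ Fin (m - 2)) where
  Adj
    | .inl a, .inl b => G.Adj a b
    | .inr i, .inr j => (SimpleGraph.pathGraph (m - 2)).Adj i j
    | .inl a, .inr i => (a = x ∧ i.val = 0) ∨ (a = y ∧ i.val + 1 = m - 2)
    | .inr i, .inl a => (a = x ∧ i.val = 0) ∨ (a = y ∧ i.val + 1 = m - 2)
  symm := ⟨by
    rintro (a | i) (b | j) h
    · exact G.adj_symm h
    · exact h
    · exact h
    · exact (SimpleGraph.pathGraph (m - 2)).adj_symm h⟩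
  loopless := ⟨by
    rintro (a | i) h
    · exact G.loopless.irrefl a h
    · exact (SimpleGraph.pathGraph (m - 2)).loopless.irrefl i h⟩

/-- The two-eared dog `D(l, l₁, l₂)` (meant for `4 ≤ l` and `3 ≤ l₁, l₂`): the snout is the cycle
`0, 1, …, l - 1`; an ear of length `l₁` is glued on along the edge `01` and an ear of length `l₂`
along the edge `23`. -/
def dog (l l₁ l₂ : ℕ) (h : 4 ≤ l) : SimpleGraph ((Fin l ⊕ Fin (l₁ - 2)) ⊕ Fin (l₂ - 2)) :=
  attachEar
    (attachEar (SimpleGraph.cycleGraph l) ⟨0, by omega⟩ ⟨1, by omega⟩ l₁)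
    (.inl ⟨2, by omega⟩) (.inl ⟨3, by omega⟩) l₂

/-! ### Contractions -/

/-- The contraction `G / U`: the vertices in `U` are removed and a new vertex `none` is added,
which is adjacent to the remaining vertices that have a neighbour in `U`. -/
def contract (G : SimpleGraph V) (U : Set V) : SimpleGraph (Option {x : V // x ∉ U}) where
  Adj
    | some x, some y => G.Adj x y
    | some x, none => ∃ a ∈ U, G.Adj a x
    | none, some x => ∃ a ∈ U, G.Adj a x
    | none, none => False
  symm := ⟨by
    rintro (_ | x) (_ | y) h
    · exact h
    · exact h
    · exact h
    · exact G.adj_symm h⟩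
  loopless := ⟨by
    rintro (_ | x) h
    · exact h
    · exact G.loopless.irrefl x h⟩

/-- A cycle `c` is non-separating if `G` has at least as many connected components as
`G - V(c)`. -/
def IsNonSeparating {G : SimpleGraph V} {a : V} (c : G.Walk a a) : Prop :=
  Cardinal.mk (G.induce {x | x ∉ c.support}).ConnectedComponent ≤
    Cardinal.mk G.ConnectedComponent

/-- The contraction of the vertices `u` and `v` is admissible if there is a vertex `w` such that
`u, w, v` is a path contained in an induced (that is, chordless) non-separating cycle of `G`. -/
def IsAdmissible (G : SimpleGraph V) (u v : V) : Prop :=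
  u ≠ v ∧ ∃ (w a : V) (c : G.Walk a a), c.IsCycle ∧ c.IsChordless ∧ IsNonSeparating c ∧
    s(u, w) ∈ c.edges ∧ s(w, v) ∈ c.edges

/-! ### The operations, with graphs taken up to isomorphism -/

/-- `H` is obtained from `G` by deleting a vertex. -/
def IsVertexDeletion (H : SimpleGraph W) (G : SimpleGraph V) : Prop :=
  ∃ v : V, Nonempty (H ≃g G.induce {x | x ≠ v})

/-- `H` is obtained from `G` by deleting an edge. -/
def IsEdgeDeletion (H : SimpleGraph W) (G : SimpleGraph V) : Prop :=
  ∃ e ∈ G.edgeSet, Nonempty (H ≃g G.deleteEdges {e})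

/-- `H` is obtained from `G` by contracting an edge. -/
def IsEdgeContraction (H : SimpleGraph W) (G : SimpleGraph V) : Prop :=
  ∃ u v : V, G.Adj u v ∧ Nonempty (H ≃g contract G {u, v})

/-- `H` is obtained from `G` by an admissible contraction. -/
def IsAdmissibleContraction (H : SimpleGraph W) (G : SimpleGraph V) : Prop :=
  ∃ u v : V, IsAdmissible G u v ∧ Nonempty (H ≃g contract G {u, v})

/-! ### The two minor relations -/

/-- `IsMinor H G`: the graph `H` (up to isomorphism) results from `G` by a finite, possibly empty,
sequence of vertex deletions, edge deletions and edge contractions. -/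
inductive IsMinor (H : SimpleGraph W) : {V : Type u} → SimpleGraph V → Prop
  | iso {V : Type u} {G : SimpleGraph V} (h : Nonempty (H ≃g G)) : IsMinor H G
  | step {V V' : Type u} {G : SimpleGraph V} {G' : SimpleGraph V'}
      (h : IsVertexDeletion G' G ∨ IsEdgeDeletion G' G ∨ IsEdgeContraction G' G)
      (h' : IsMinor H G') : IsMinor H G

/-- `IsBipartiteMinor H G`: the graph `H` (up to isomorphism) results from `G` by a finite, possibly
empty, sequence of vertex deletions, edge deletions and admissible contractions. -/
inductive IsBipartiteMinor (H : SimpleGraph W) : {V : Type u} → SimpleGraph V → Prop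
  | iso {V : Type u} {G : SimpleGraph V} (h : Nonempty (H ≃g G)) : IsBipartiteMinor H G
  | step {V V' : Type u} {G : SimpleGraph V} {G' : SimpleGraph V'}
      (h : IsVertexDeletion G' G ∨ IsEdgeDeletion G' G ∨ IsAdmissibleContraction G' G)
      (h' : IsBipartiteMinor H G') : IsBipartiteMinor H G

end BipartiteMinors

/-! That the short dog is a minor is seen by contracting snout edges one at a time (`isMinor_dog`).
The negative half rests on an invariant of the binary cycle space, whose elements are read as edge
sets: the sum is the symmetric difference, and the pointwise product is the intersection.

A graph is trapped at level `L` if its cycle space has rank at most 2, or has rank at most 3 and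
contains a block, or looks like that of a dog with at least `L` snout edges (a frame). The long dog
is a frame at `L = l + k` (`isFrame_dog`). The short dog is not trapped at that level
(`not_isTrapped_dog`): its rank is 3, it has no block, and the snout of any frame in it is contained
in its own snout, hence too short.

The trap survives deletions, because the cycle space of a subgraph embeds in the old one: either
nothing is lost, or the rank falls to at most 2 (`IsTrapped.of_injective`). For an admissible
contraction of `u` and `v` with common neighbour `w`, pushing forward maps the cycle space onto the
new one (`IsFold.exists_push_eq`). If this map is not injective, the rank falls again. If it is
injective, the only edges that become equal are `uw` and `vw`. In a frame the induced cycles are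
ears or the snout (`IsFrame.chain_cases`), and a non-separating one cannot be the snout
(`IsFrame.chain_ne_snout`), so `u, w, v` lies on an ear. If the snout avoids both edges, the frame
survives with its snout unshortened; otherwise the edge shared by ear and snout cancels out of the
ear, which becomes a block (`IsFold.isTrapped_of_frame`). Blocks survive in turn
(`IsFold.isTrapped_of_block`). -/

namespace BipartiteMinors

open SimpleGraph Module

/-! ### The binary cycle space as a space of symmetric matrices. -/

noncomputable section CycleSpace

set_option linter.unusedSectionVars false

open scoped Classical

variable {V W : Type*} [Fintype V] [Fintype W]

/-- The binary cycle space of `G`, as a space of symmetric matrices over `ZMod 2` that are supported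
on the edges of `G` and whose rows sum to zero. -/
def cycleSpace (G : SimpleGraph V) : Submodule (ZMod 2) (V → V → ZMod 2) where
  carrier := {f | (∀ x y, f x y = f y x) ∧ (∀ x y, f x y ≠ 0 → G.Adj x y) ∧ ∀ x, ∑ y, f x y = 0}
  add_mem' := by
    rintro f g ⟨hf, hf', hf''⟩ ⟨hg, hg', hg''⟩
    refine ⟨fun x y => ?_, fun x y h => ?_, fun x => ?_⟩
    · simp [hf x y, hg x y]
    · by_cases h1 : f x y = 0
      · exact hg' x y (by simpa [h1] using h)
      · exact hf' x y h1
    · simp [Finset.sum_add_distrib, hf'', hg'']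
  zero_mem' := by simp
  smul_mem' := by
    rintro c f ⟨hf, hf', hf''⟩
    refine ⟨fun x y => ?_, fun x y h => ?_, fun x => ?_⟩
    · simp [hf x y]
    · exact hf' x y (fun h0 => h (by simp [h0]))
    · simp [← Finset.mul_sum, hf'']

theorem zmod_two_cases (a : ZMod 2) : a = 0 ∨ a = 1 := by
  revert a; decide

theorem zmod_two_add_self (a : ZMod 2) : a + a = 0 := by
  revert a; decide

theorem mat_add_self (f : V → V → ZMod 2) : f + f = 0 := by
  funext x y; exact zmod_two_add_self _

section Basic

variable {G : SimpleGraph V} {f g : V → V → ZMod 2}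

theorem symm_of_mem (hf : f ∈ cycleSpace G) (x y : V) : f x y = f y x := hf.1 x y

theorem adj_of_mem (hf : f ∈ cycleSpace G) {x y : V} (h : f x y ≠ 0) : G.Adj x y := hf.2.1 x y h

theorem eq_zero_of_mem (hf : f ∈ cycleSpace G) {x y : V} (h : ¬ G.Adj x y) : f x y = 0 := by
  by_contra h'; exact h (hf.2.1 x y h')

theorem row_sum_of_mem (hf : f ∈ cycleSpace G) (x : V) : ∑ y, f x y = 0 := hf.2.2 x

theorem exists_ne_of_mem (hf : f ∈ cycleSpace G) {x y : V} (h : f x y ≠ 0) :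
    ∃ z, z ≠ y ∧ f x z ≠ 0 := by
  by_contra! h'
  apply h
  rw [← row_sum_of_mem hf x]
  exact (Finset.sum_eq_single y (fun b _ hb => h' b hb) (by simp)).symm

/-- A row with at most two nonzero entries sums to zero modulo 2 only if they agree. This carries
values along paths of vertices of degree two. -/
theorem eq_of_two_neighbors (hf : f ∈ cycleSpace G) {x a b : V} (hab : a ≠ b)
    (h : ∀ y, G.Adj x y → y = a ∨ y = b) : f x a = f x b := by
  have h1 := row_sum_of_mem hf x
  rw [Finset.sum_eq_add a b hab] at h1
  · rcases zmod_two_cases (f x a) with ha | ha <;> rcases zmod_two_cases (f x b) with hb | hb <;>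
      simp_all
  · rintro c - ⟨hca, hcb⟩
    refine eq_zero_of_mem hf fun hc => ?_
    rcases h c hc with h | h <;> contradiction
  · simp
  · simp

end Basic

/-- The matrix of a single edge. -/
def edgeMat (p q : V) (x y : V) : ZMod 2 := if s(x, y) = s(p, q) then 1 else 0

theorem edgeMat_symm (p q x y : V) : edgeMat p q x y = edgeMat p q y x := by
  unfold edgeMat; rw [Sym2.eq_swap]

theorem edgeMat_swap (p q : V) : edgeMat p q = edgeMat q p := by
  funext x y; unfold edgeMat; rw [Sym2.eq_swap (a := p)]

theorem edgeMat_self (p q : V) : edgeMat p q p q = 1 := by simp [edgeMat]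

theorem edgeMat_ne_zero {p q x y : V} : edgeMat p q x y ≠ 0 ↔ s(x, y) = s(p, q) := by
  unfold edgeMat; split_ifs with h <;> simp [h]

theorem edgeMat_eq_add {p q : V} (h : p ≠ q) (x y : V) : edgeMat p q x y =
    (if y = q then (if x = p then 1 else 0) else 0) +
      (if y = p then (if x = q then 1 else 0) else 0) := by
  simp only [edgeMat, Sym2.eq_iff]
  by_cases h1 : x = p <;> by_cases h2 : x = q <;> by_cases h3 : y = p <;> by_cases h4 : y = q <;>
    simp_all

theorem sum_edgeMat {p q : V} (h : p ≠ q) (x : V) :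
    ∑ y, edgeMat p q x y = (if x = p then 1 else 0) + (if x = q then 1 else 0) := by
  simp [edgeMat_eq_add h, Finset.sum_add_distrib]

/-- The sum of the edges of a walk. -/
def chain {G : SimpleGraph V} : {a b : V} → G.Walk a b → V → V → ZMod 2
  | _, _, .nil => 0
  | _, _, .cons (u := u) (v := v) _ p => edgeMat u v + chain p

section Chain

variable {G : SimpleGraph V}

theorem chain_symm {a b : V} (p : G.Walk a b) (x y : V) : chain p x y = chain p y x := by
  induction p with
  | nil => rfl
  | cons h p ih => simp [chain, ih, edgeMat_symm _ _ x y]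

theorem chain_eq_zero {a b : V} (p : G.Walk a b) {x y : V} (h : s(x, y) ∉ p.edges) :
    chain p x y = 0 := by
  induction p with
  | nil => rfl
  | cons h' p ih =>
    simp only [Walk.edges_cons, List.mem_cons, not_or] at h
    simp [chain, ih h.2, edgeMat, h.1]

theorem chain_eq_one {a b : V} {p : G.Walk a b} (hp : p.IsTrail) {x y : V} (h : s(x, y) ∈ p.edges) :
    chain p x y = 1 := by
  induction p with
  | nil => simp at h
  | cons h' p ih =>
    rw [Walk.isTrail_cons] at hp
    simp only [Walk.edges_cons, List.mem_cons] at h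
    by_cases h1 : s(x, y) ∈ p.edges
    · have : s(x, y) ≠ s(_, _) := fun h2 => hp.2 (h2 ▸ h1)
      simp [chain, ih hp.1 h1, edgeMat, this]
    · rcases h with h | h
      · simp [chain, chain_eq_zero p h1, edgeMat, h]
      · contradiction

theorem sum_chain {a b : V} (p : G.Walk a b) (x : V) :
    ∑ y, chain p x y = (if x = a then 1 else 0) + (if x = b then 1 else 0) := by
  induction p with
  | nil => simp [chain, zmod_two_add_self]
  | @cons u v w h p ih =>
    simp only [chain, Pi.add_apply, Finset.sum_add_distrib, ih, sum_edgeMat h.ne]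
    generalize (if x = u then (1 : ZMod 2) else 0) = r
    generalize (if x = v then (1 : ZMod 2) else 0) = s
    generalize (if x = w then (1 : ZMod 2) else 0) = t
    revert r s t; decide

theorem chain_mem {a : V} (p : G.Walk a a) : chain p ∈ cycleSpace G := by
  refine ⟨chain_symm p, fun x y h => ?_, fun x => ?_⟩
  · by_contra h'
    exact h (chain_eq_zero p fun h2 => h' (p.adj_of_mem_edges h2))
  · rw [sum_chain, zmod_two_add_self]

/-- The first edge of the path would be the only support edge at its first vertex, against the row
sum; so it drops out, and induction handles the rest. -/
theorem eq_zero_of_support_path {a b : V} {p : G.Walk a b} (hp : p.IsPath) {f : V → V → ZMod 2}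
    (hf : f ∈ cycleSpace G) (h : ∀ x y, f x y ≠ 0 → s(x, y) ∈ p.edges) : f = 0 := by
  induction p with
  | nil => funext x y; by_contra h'; simpa using h x y h'
  | @cons u v w hadj p ih =>
    rw [Walk.cons_isPath_iff] at hp
    refine ih hp.1 fun x y hxy => ?_
    have h1 := h x y hxy
    simp only [Walk.edges_cons, List.mem_cons] at h1
    refine h1.resolve_left fun h2 => ?_
    have key : f u v ≠ 0 := by
      rcases Sym2.eq_iff.1 h2 with ⟨rfl, rfl⟩ | ⟨rfl, rfl⟩
      · exact hxy
      · rwa [symm_of_mem hf]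
    obtain ⟨z, hz, hz'⟩ := exists_ne_of_mem hf key
    have h3 := h u z hz'
    simp only [Walk.edges_cons, List.mem_cons] at h3
    rcases h3 with h3 | h3
    · rcases Sym2.eq_iff.1 h3 with ⟨-, rfl⟩ | ⟨rfl, rfl⟩
      · exact hz rfl
      · exact hadj.ne rfl
    · exact hp.2 (p.fst_mem_support_of_mem_edges h3)

/-- The only elements of the cycle space that are supported on a cycle are zero and the cycle. -/
theorem eq_zero_or_eq_chain {a : V} {c : G.Walk a a} (hc : c.IsCycle) {f : V → V → ZMod 2}
    (hf : f ∈ cycleSpace G) (h : ∀ x y, f x y ≠ 0 → s(x, y) ∈ c.edges) : f = 0 ∨ f = chain c := by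
  cases c with
  | nil => exact absurd hc Walk.not_isCycle_nil
  | @cons _ v _ hadj p =>
    have hc' := (Walk.cons_isCycle_iff p hadj).1 hc
    -- Without its first edge the cycle is a path, which supports no nonzero element. When `f`
    -- contains that edge, the same applies to `f` plus the cycle.
    have main : ∀ g ∈ cycleSpace G, (∀ x y, g x y ≠ 0 → s(x, y) ∈ (Walk.cons hadj p).edges) →
        g a v = 0 → g = 0 := by
      intro g hg hgs h0
      refine eq_zero_of_support_path hc'.1 hg fun x y hxy => ?_
      have h1 := hgs x y hxy
      simp only [Walk.edges_cons, List.mem_cons] at h1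
      refine h1.resolve_left fun h2 => hxy ?_
      rcases Sym2.eq_iff.1 h2 with ⟨rfl, rfl⟩ | ⟨rfl, rfl⟩
      · exact h0
      · rwa [symm_of_mem hg]
    rcases zmod_two_cases (f a v) with h0 | h0
    · exact Or.inl (main f hf h h0)
    · right
      have h1 := main (f + chain (Walk.cons hadj p)) (add_mem hf (chain_mem _)) (fun x y hxy => by
        by_contra h2
        apply hxy
        have : f x y = 0 := by by_contra h3; exact h2 (h x y h3)
        simp [this, chain_eq_zero _ h2]) (by
        have := chain_eq_one hc.isCircuit.isTrail (x := a) (y := v) (by simp)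
        simp only [Pi.add_apply, h0, this]; rfl)
      rw [← add_zero f, ← mat_add_self (chain (Walk.cons hadj p)), ← add_assoc, h1, zero_add]

end Chain

end CycleSpace

/-! ### Push-forward of matrices along vertex maps. -/

noncomputable section Push

set_option linter.unusedSectionVars false

open scoped Classical

variable {V W : Type*} [Fintype V] [Fintype W]

/-- The push-forward of a matrix along a map, summing over fibres. -/
def push (π : V → W) : (V → V → ZMod 2) →ₗ[ZMod 2] (W → W → ZMod 2) where
  toFun f a b := ∑ x with π x = a, ∑ y with π y = b, f x y
  map_add' f g := by funext a b; simp [Finset.sum_add_distrib]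
  map_smul' c f := by funext a b; simp [Finset.mul_sum]

theorem push_apply (π : V → W) (f : V → V → ZMod 2) (a b : W) :
    push π f a b = ∑ x with π x = a, ∑ y with π y = b, f x y := rfl

theorem push_row_sum (π : V → W) (f : V → V → ZMod 2) (a : W) :
    ∑ b, push π f a b = ∑ x with π x = a, ∑ y, f x y := by
  simp only [push_apply]
  rw [Finset.sum_comm]
  refine Finset.sum_congr rfl fun x _ => ?_
  exact Finset.sum_fiberwise _ _ _

theorem push_symm (π : V → W) {f : V → V → ZMod 2} (hf : ∀ x y, f x y = f y x) (a b : W) :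
    push π f a b = push π f b a := by
  simp only [push_apply]
  rw [Finset.sum_comm]
  simp only [hf]

theorem push_ne_zero {π : V → W} {f : V → V → ZMod 2} {a b : W} (h : push π f a b ≠ 0) :
    ∃ x y, π x = a ∧ π y = b ∧ f x y ≠ 0 := by
  obtain ⟨x, hx, hx'⟩ := Finset.exists_ne_zero_of_sum_ne_zero h
  obtain ⟨y, hy, hy'⟩ := Finset.exists_ne_zero_of_sum_ne_zero hx'
  exact ⟨x, y, by simpa using hx, by simpa using hy, hy'⟩

/-- An edge inside a fibre is counted once in each direction and so vanishes modulo 2: no loops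
arise. -/
theorem push_diag (π : V → W) {f : V → V → ZMod 2} (hf : ∀ x y, f x y = f y x)
    (hf' : ∀ x, f x x = 0) (a : W) : push π f a a = 0 := by
  rw [push_apply, ← Finset.sum_product']
  refine Finset.sum_involution (fun p _ => p.swap) ?_ ?_ ?_ ?_
  · rintro ⟨x, y⟩ -
    simp only [Prod.fst_swap, Prod.snd_swap]
    rw [hf y x, zmod_two_add_self]
  · rintro ⟨x, y⟩ - h h'
    obtain rfl : y = x := congrArg Prod.fst h'
    exact h (hf' _)
  · rintro ⟨x, y⟩ h
    simp only [Finset.mem_product, Prod.swap] at h ⊢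
    exact h.symm
  · rintro ⟨x, y⟩ -; rfl

theorem push_mem {G : SimpleGraph V} {H : SimpleGraph W} {π : V → W}
    (hπ : ∀ x y, G.Adj x y → π x ≠ π y → H.Adj (π x) (π y)) {f : V → V → ZMod 2}
    (hf : f ∈ cycleSpace G) : push π f ∈ cycleSpace H := by
  refine ⟨push_symm π hf.1, fun a b h => ?_, fun a => ?_⟩
  · obtain ⟨x, y, rfl, rfl, hxy⟩ := push_ne_zero h
    refine hπ x y (adj_of_mem hf hxy) fun h' => h ?_
    rw [h']
    exact push_diag π hf.1 (fun x => eq_zero_of_mem hf G.irrefl) _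
  · rw [push_row_sum]
    exact Finset.sum_eq_zero fun x _ => row_sum_of_mem hf x

theorem push_edgeMat {π : V → W} {p q : V} (h : π p ≠ π q) :
    push π (edgeMat p q) = edgeMat (π p) (π q) := by
  have hpq : p ≠ q := fun h' => h (h' ▸ rfl)
  funext a b
  rw [push_apply]
  simp only [edgeMat_eq_add hpq, edgeMat_eq_add h, Finset.sum_add_distrib, Finset.sum_ite_eq',
    Finset.mem_filter, Finset.mem_univ, true_and]
  have e : ∀ (P : Prop) (z : V), ∑ x with π x = a, (if P then if x = z then (1 : ZMod 2) else 0
      else 0) = if P then (if π z = a then 1 else 0) else 0 := by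
    intro P z; split_ifs with h1 <;> simp_all
  simp only [e]
  by_cases h1 : π p = a <;> by_cases h2 : π q = a <;> by_cases h3 : π p = b <;>
    by_cases h4 : π q = b <;> simp_all [eq_comm]

section Injective

variable {π : V → W}


theorem push_apply_of_injective (hπ : Function.Injective π) (f : V → V → ZMod 2)
    (x y : V) : push π f (π x) (π y) = f x y := by
  rw [push_apply]
  have : ∀ x, (Finset.univ.filter fun z => π z = π x) = {x} := by
    intro x; ext z; simp [hπ.eq_iff]
  simp [this]

theorem push_injective (hπ : Function.Injective π) : Function.Injective (push π) := by
  intro f g h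
  funext x y
  rw [← push_apply_of_injective hπ f, h, push_apply_of_injective hπ]

theorem push_mul_of_injective (hπ : Function.Injective π) (f g : V → V → ZMod 2) :
    push π (f * g) = push π f * push π g := by
  funext a b
  by_cases h : ∃ x y, π x = a ∧ π y = b
  · obtain ⟨x, y, rfl, rfl⟩ := h
    simp [push_apply_of_injective hπ]
  · have : ∀ f : V → V → ZMod 2, push π f a b = 0 := by
      intro f
      by_contra h'
      obtain ⟨x, y, hx, hy, -⟩ := push_ne_zero h'
      exact h ⟨x, y, hx, hy⟩
    simp [this]

end Injective

end Push

/-! ### The invariant, and its inheritance by subgraphs. -/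

noncomputable section Traps

set_option linter.unusedSectionVars false

open scoped Classical

variable {V W : Type*} [Fintype V] [Fintype W]

/-- A nonzero element of the cycle space all or none of which lies in any other element. -/
def IsBlock (G : SimpleGraph V) (x : V → V → ZMod 2) : Prop :=
  x ∈ cycleSpace G ∧ x ≠ 0 ∧ ∀ f ∈ cycleSpace G, x * f = 0 ∨ x * f = x

/-- The cycle space is spanned as that of a dog whose snout has length at least `L`: there are two
disjoint ears, each with exactly one edge on the snout. -/
structure IsFrame (G : SimpleGraph V) (L : ℕ) (A₁ A₂ S : V → V → ZMod 2) : Prop where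
  mem₁ : A₁ ∈ cycleSpace G
  mem₂ : A₂ ∈ cycleSpace G
  memS : S ∈ cycleSpace G
  mul_ears : A₁ * A₂ = 0
  mul₁ : ∃ p q, A₁ * S = edgeMat p q
  mul₂ : ∃ p q, A₂ * S = edgeMat p q
  card : 2 * L ≤ (Finset.univ.filter fun e : V × V => S e.1 e.2 ≠ 0).card
  span : ∀ f ∈ cycleSpace G, ∃ α β γ : ZMod 2, f = α • A₁ + β • A₂ + γ • S

/-- The property that is invariant under the operations of bipartite minors. -/
def IsTrapped (G : SimpleGraph V) (L : ℕ) : Prop :=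
  finrank (ZMod 2) (cycleSpace G) ≤ 2 ∨
  (finrank (ZMod 2) (cycleSpace G) ≤ 3 ∧ ∃ x, IsBlock G x) ∨
  ∃ A₁ A₂ S, IsFrame G L A₁ A₂ S

theorem IsFrame.symm {G : SimpleGraph V} {L : ℕ} {A₁ A₂ S : V → V → ZMod 2}
    (h : IsFrame G L A₁ A₂ S) : IsFrame G L A₂ A₁ S where
  mem₁ := h.mem₂
  mem₂ := h.mem₁
  memS := h.memS
  mul_ears := by rw [mul_comm]; exact h.mul_ears
  mul₁ := h.mul₂
  mul₂ := h.mul₁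
  card := h.card
  span f hf := by
    obtain ⟨α, β, γ, rfl⟩ := h.span f hf
    exact ⟨β, α, γ, by rw [add_comm (β • A₂)]⟩

theorem IsFrame.finrank_le {G : SimpleGraph V} {L : ℕ} {A₁ A₂ S : V → V → ZMod 2}
    (h : IsFrame G L A₁ A₂ S) : finrank (ZMod 2) (cycleSpace G) ≤ 3 := by
  have h1 : cycleSpace G ≤ Submodule.span (ZMod 2) (({A₁, A₂, S} : Finset _) : Set _) := by
    intro f hf
    obtain ⟨α, β, γ, rfl⟩ := h.span f hf
    refine add_mem (add_mem ?_ ?_) ?_ <;> refine Submodule.smul_mem _ _ (Submodule.subset_span ?_)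
      <;> simp
  calc _ ≤ _ := Submodule.finrank_mono h1
    _ ≤ _ := finrank_span_finset_le_card _
    _ ≤ 3 := Finset.card_le_three

theorem IsTrapped.finrank_le {G : SimpleGraph V} {L : ℕ} (h : IsTrapped G L) :
    finrank (ZMod 2) (cycleSpace G) ≤ 3 := by
  rcases h with h | ⟨h, -⟩ | ⟨A₁, A₂, S, h⟩
  · omega
  · exact h
  · exact h.finrank_le

theorem exists_edgeMat_of_push {π : V → W} (hπ : Function.Injective π) {f : V → V → ZMod 2}
    (h : ∃ p q, push π f = edgeMat p q) : ∃ p q, f = edgeMat p q := by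
  obtain ⟨p, q, h⟩ := h
  have h1 : push π f p q ≠ 0 := by rw [h, edgeMat_self]; decide
  obtain ⟨x, y, rfl, rfl, -⟩ := push_ne_zero h1
  refine ⟨x, y, ?_⟩
  funext a b
  rw [← push_apply_of_injective hπ f, h]
  have : s(π a, π b) = s(π x, π y) ↔ s(a, b) = s(x, y) := by
    rw [Sym2.eq_iff, Sym2.eq_iff, hπ.eq_iff, hπ.eq_iff, hπ.eq_iff, hπ.eq_iff]
  unfold edgeMat
  simp only [this]

/-- The trap is inherited by subgraphs. -/
theorem IsTrapped.of_injective {G : SimpleGraph V} {H : SimpleGraph W} {L : ℕ} {π : W → V}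
    (hπ : Function.Injective π) (hadj : ∀ x y, H.Adj x y → G.Adj (π x) (π y))
    (h : IsTrapped G L) : IsTrapped H L := by
  have hle : (cycleSpace H).map (push π) ≤ cycleSpace G := by
    rintro _ ⟨f, hf, rfl⟩
    exact push_mem (fun x y hxy _ => hadj x y hxy) hf
  have hrank : finrank (ZMod 2) ((cycleSpace H).map (push π)) =
      finrank (ZMod 2) (cycleSpace H) :=
    (Submodule.equivMapOfInjective _ (push_injective hπ) _).finrank_eq.symm
  -- A proper subspace of a space of rank at most 3 has rank at most 2, which is already a trap. So
  -- the two cycle spaces may be identified.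
  rcases hle.eq_or_lt with heq | hlt
  swap
  · have h1 := Submodule.finrank_lt_finrank_of_lt hlt
    have h2 := h.finrank_le
    exact Or.inl (by omega)
  have pull : ∀ f ∈ cycleSpace G, ∃ g ∈ cycleSpace H, push π g = f := by
    intro f hf; rw [← heq] at hf; exact hf
  have fwd : ∀ g ∈ cycleSpace H, push π g ∈ cycleSpace G := fun g hg => hle ⟨g, hg, rfl⟩
  rw [heq] at hrank
  rcases h with h | ⟨h, x, hx, hx0, hxb⟩ | ⟨A₁, A₂, S, h⟩
  · exact Or.inl (by omega)
  · obtain ⟨x, hx', rfl⟩ := pull x hx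
    refine Or.inr (Or.inl ⟨by omega, x, hx', fun h0 => hx0 (by simp [h0]), fun f hf => ?_⟩)
    have := hxb _ (fwd f hf)
    rwa [← push_mul_of_injective hπ, (push_injective hπ).eq_iff,
      map_eq_zero_iff _ (push_injective hπ)] at this
  · obtain ⟨A₁, h₁, rfl⟩ := pull A₁ h.mem₁
    obtain ⟨A₂, h₂, rfl⟩ := pull A₂ h.mem₂
    obtain ⟨S, hS, rfl⟩ := pull S h.memS
    refine Or.inr (Or.inr ⟨A₁, A₂, S, h₁, h₂, hS, ?_, ?_, ?_, ?_, fun f hf => ?_⟩)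
    · have := h.mul_ears
      rwa [← push_mul_of_injective hπ, map_eq_zero_iff _ (push_injective hπ)] at this
    · have := h.mul₁
      rw [← push_mul_of_injective hπ] at this
      exact exists_edgeMat_of_push hπ this
    · have := h.mul₂
      rw [← push_mul_of_injective hπ] at this
      exact exists_edgeMat_of_push hπ this
    · refine h.card.trans (le_of_eq ?_)
      symm
      rw [← Finset.card_map ⟨Prod.map π π, hπ.prodMap hπ⟩]
      congr 1
      ext ⟨a, b⟩
      simp only [Finset.mem_map, Finset.mem_filter, Finset.mem_univ, true_and,
        Function.Embedding.coeFn_mk, Prod.exists, Prod.map_apply, Prod.mk.injEq]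
      constructor
      · rintro ⟨x, y, hxy, rfl, rfl⟩
        rwa [push_apply_of_injective hπ]
      · intro hab
        obtain ⟨x, y, rfl, rfl, hxy⟩ := push_ne_zero hab
        exact ⟨x, y, hxy, rfl, rfl⟩
    · obtain ⟨α, β, γ, e⟩ := h.span _ (fwd f hf)
      refine ⟨α, β, γ, push_injective hπ ?_⟩
      rw [e]; simp

end Traps

/-! ### Identifying two vertices with a common neighbour: lifting cycles. -/

noncomputable section Folds

set_option linter.unusedSectionVars false

open scoped Classical

variable {V W : Type*} [Fintype V] [Fintype W]

/-- The map `π` exhibits `H` as the graph obtained from `G` by identifying `u` and `v`. -/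
structure IsFold (G : SimpleGraph V) (H : SimpleGraph W) (π : V → W) (u v : V) : Prop where
  ne : u ≠ v
  map_eq : π u = π v
  eq_or : ∀ x y, π x = π y → x = y ∨ (x = u ∧ y = v) ∨ (x = v ∧ y = u)
  surj : Function.Surjective π
  adj_iff : ∀ a b, H.Adj a b ↔ a ≠ b ∧ ∃ x y, π x = a ∧ π y = b ∧ G.Adj x y

namespace IsFold

variable {G : SimpleGraph V} {H : SimpleGraph W} {π : V → W} {u v w : V}

theorem push_mem (h : IsFold G H π u v) {f : V → V → ZMod 2} (hf : f ∈ cycleSpace G) :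
    push π f ∈ cycleSpace H :=
  BipartiteMinors.push_mem
    (fun x y hxy hne => (h.adj_iff _ _).2 ⟨hne, x, y, rfl, rfl, hxy⟩) hf

theorem map_ne (h : IsFold G H π u v) {x : V} (hu : x ≠ u) (hv : x ≠ v) : π x ≠ π u := by
  intro h'
  rcases h.eq_or x u h' with h | ⟨h, -⟩ | ⟨h, -⟩ <;> contradiction

theorem filter_eq (h : IsFold G H π u v) {x : V} (hu : x ≠ u) (hv : x ≠ v) :
    (Finset.univ.filter fun z => π z = π x) = {x} := by
  ext z
  simp only [Finset.mem_filter, Finset.mem_univ, true_and, Finset.mem_singleton]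
  refine ⟨fun h' => ?_, fun h' => h' ▸ rfl⟩
  rcases h.eq_or z x h' with h | ⟨-, h⟩ | ⟨-, h⟩
  · exact h
  · contradiction
  · contradiction

theorem filter_eq_pair (h : IsFold G H π u v) :
    (Finset.univ.filter fun z => π z = π u) = {u, v} := by
  ext z
  simp only [Finset.mem_filter, Finset.mem_univ, true_and, Finset.mem_insert,
    Finset.mem_singleton]
  constructor
  · intro h'
    rcases h.eq_or z u h' with h | ⟨h, -⟩ | ⟨h, -⟩
    · exact Or.inl h
    · exact Or.inl h
    · exact Or.inr h
  · rintro (rfl | rfl)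
    · rfl
    · exact h.map_eq.symm

theorem push_apply (h : IsFold G H π u v) (f : V → V → ZMod 2) {x y : V} (hxu : x ≠ u)
    (hxv : x ≠ v) (hyu : y ≠ u) (hyv : y ≠ v) : push π f (π x) (π y) = f x y := by
  rw [BipartiteMinors.push_apply, h.filter_eq hxu hxv, h.filter_eq hyu hyv]
  simp

theorem push_apply_left (h : IsFold G H π u v) (f : V → V → ZMod 2) {y : V}
    (hyu : y ≠ u) (hyv : y ≠ v) : push π f (π u) (π y) = f u y + f v y := by
  rw [BipartiteMinors.push_apply, h.filter_eq_pair, h.filter_eq hyu hyv]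
  simp [Finset.sum_pair h.ne]

theorem push_edgeMat_self (h : IsFold G H π u v) : push π (edgeMat u v) = 0 := by
  funext a b
  by_contra h'
  obtain ⟨x, y, rfl, rfl, hxy⟩ := push_ne_zero h'
  have h1 : π x = π y := by
    rcases Sym2.eq_iff.1 (edgeMat_ne_zero.1 hxy) with ⟨rfl, rfl⟩ | ⟨rfl, rfl⟩
    · exact h.map_eq
    · exact h.map_eq.symm
  apply h'
  rw [h1]
  refine push_diag π (edgeMat_symm u v) (fun x => ?_) _
  by_contra h2
  rcases Sym2.eq_iff.1 (edgeMat_ne_zero.1 h2) with ⟨rfl, h3⟩ | ⟨rfl, h3⟩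
  · exact h.ne h3
  · exact h.ne h3.symm

/-- The two edges have the same image, so they cancel. -/
theorem push_path (h : IsFold G H π u v) {y : V} (hu : y ≠ u) (hv : y ≠ v) :
    push π (edgeMat u y + edgeMat y v) = 0 := by
  rw [map_add, push_edgeMat (h.map_ne hu hv).symm, push_edgeMat (h.map_eq ▸ h.map_ne hu hv),
    ← h.map_eq, edgeMat_swap (π y), mat_add_self]

/-- Lift each edge of `g` to one preimage. The only row sums that can fail are those at `u` and `v`,
and these are equal; if both are odd, adding the path `u, w, v` repairs them without changing the
push-forward. -/
theorem exists_push_eq (h : IsFold G H π u v) (hu : G.Adj u w) (hv : G.Adj w v)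
    {g : W → W → ZMod 2} (hg : g ∈ cycleSpace H) : ∃ f ∈ cycleSpace G, push π f = g := by
  -- `P` selects one preimage of every edge of `H`: at a common neighbour of `u` and `v`, the edge
  -- to `u` is kept and the edge to `v` is dropped.
  let P : V → V → Prop := fun x y => G.Adj x y ∧ ¬ (x = v ∧ G.Adj u y) ∧ ¬ (y = v ∧ G.Adj u x)
  have hP : ∀ x y, P x y → P y x := fun x y hxy => ⟨hxy.1.symm, hxy.2.2, hxy.2.1⟩
  let f : V → V → ZMod 2 := fun x y => if P x y then g (π x) (π y) else 0
  have hfs : ∀ x y, f x y = f y x := by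
    intro x y
    simp only [f, symm_of_mem hg (π x), (⟨hP x y, hP y x⟩ : P x y ↔ P y x)]
  have hfa : ∀ x y, f x y ≠ 0 → G.Adj x y := by
    intro x y hxy
    by_contra h'
    exact hxy (if_neg fun h2 => h' h2.1)
  have hpush : push π f = g := by
    funext a b
    by_cases hab : g a b = 0
    · rw [hab, BipartiteMinors.push_apply]
      refine Finset.sum_eq_zero fun x hx => Finset.sum_eq_zero fun y hy => ?_
      simp only [Finset.mem_filter, Finset.mem_univ, true_and] at hx hy
      simp [f, hx, hy, hab]
    · obtain ⟨hne, x, y, rfl, rfl, hxy⟩ := (h.adj_iff a b).1 (adj_of_mem hg hab)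
      have hex : ∃ x' y', π x' = π x ∧ π y' = π y ∧ P x' y' := by
        by_cases h1 : x = v ∧ G.Adj u y
        · refine ⟨u, y, ?_, rfl, h1.2, fun h2 => h.ne h2.1, fun h2 => ?_⟩
          · rw [h1.1, h.map_eq]
          · rw [h1.1, h2.1] at hne; exact hne rfl
        · by_cases h2 : y = v ∧ G.Adj u x
          · refine ⟨x, u, rfl, ?_, h2.2.symm, fun h3 => ?_, fun h3 => h.ne h3.1⟩
            · rw [h2.1, h.map_eq]
            · rw [h2.1, h3.1] at hne; exact hne rfl
          · exact ⟨x, y, rfl, rfl, hxy, h1, h2⟩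
      obtain ⟨x', y', hx', hy', hPxy⟩ := hex
      have huniq : ∀ x₁ y₁, π x₁ = π x → π y₁ = π y → P x₁ y₁ → x₁ = x' ∧ y₁ = y' := by
        intro x₁ y₁ hx₁ hy₁ hP₁
        rw [← hx'] at hx₁ hne
        rw [← hy'] at hy₁ hne
        obtain ⟨ha, hb, hc⟩ := hPxy
        obtain ⟨ha', hb', hc'⟩ := hP₁
        have hmap := h.map_eq
        have ha₁ := ha.symm
        have ha₂ := ha'.symm
        rcases h.eq_or _ _ hx₁ with e1 | ⟨e1, e2⟩ | ⟨e1, e2⟩ <;>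
          rcases h.eq_or _ _ hy₁ with e3 | ⟨e3, e4⟩ | ⟨e3, e4⟩ <;> grind
      rw [BipartiteMinors.push_apply, Finset.sum_eq_single x', Finset.sum_eq_single y']
      · simp only [f, if_pos hPxy, hx', hy']
      · intro y₁ hy₁ hne₁
        simp only [Finset.mem_filter, Finset.mem_univ, true_and] at hy₁
        exact if_neg fun h3 => hne₁ (huniq _ _ hx' hy₁ h3).2
      · intro h3; exact absurd (by simpa using hy') h3
      · intro x₁ hx₁ hne₁
        refine Finset.sum_eq_zero fun y₁ hy₁ => ?_
        simp only [Finset.mem_filter, Finset.mem_univ, true_and] at hx₁ hy₁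
        exact if_neg fun h3 => hne₁ (huniq _ _ hx₁ hy₁ h3).1
      · intro h3; exact absurd (by simpa using hx') h3
  have hrow : ∀ a, ∑ x with π x = a, ∑ y, f x y = 0 := by
    intro a
    rw [← push_row_sum, hpush, row_sum_of_mem hg]
  have hrow1 : ∀ x, x ≠ u → x ≠ v → ∑ y, f x y = 0 := by
    intro x hxu hxv
    have := hrow (π x)
    rwa [h.filter_eq hxu hxv, Finset.sum_singleton] at this
  have hrow2 : ∑ y, f u y = ∑ y, f v y := by
    have := hrow (π u)
    rw [h.filter_eq_pair, Finset.sum_pair h.ne] at this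
    revert this
    generalize ∑ y, f u y = r
    generalize ∑ y, f v y = s
    revert r s; decide
  rcases zmod_two_cases (∑ y, f u y) with h0 | h1
  · refine ⟨f, ⟨hfs, hfa, fun x => ?_⟩, hpush⟩
    by_cases hxu : x = u
    · rw [hxu, h0]
    by_cases hxv : x = v
    · rw [hxv, ← hrow2, h0]
    exact hrow1 x hxu hxv
  · refine ⟨f + (edgeMat u w + edgeMat w v), ⟨fun x y => ?_, fun x y hxy => ?_, fun x => ?_⟩, ?_⟩
    · simp only [Pi.add_apply, hfs x y, edgeMat_symm _ _ x y]
    · by_contra h'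
      have e0 : f x y = 0 := by by_contra h2; exact h' (hfa _ _ h2)
      have e1 : ∀ {p q}, G.Adj p q → edgeMat p q x y = 0 := by
        intro p q hpq
        by_contra h2
        rcases Sym2.eq_iff.1 (edgeMat_ne_zero.1 h2) with ⟨rfl, rfl⟩ | ⟨rfl, rfl⟩
        · exact h' hpq
        · exact h' hpq.symm
      exact hxy (by simp [e0, e1 hu, e1 hv])
    · simp only [Pi.add_apply, Finset.sum_add_distrib, sum_edgeMat hu.ne, sum_edgeMat hv.ne]
      by_cases hxu : x = u
      · subst hxu
        simp only [h1, hu.ne, h.ne]; decide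
      by_cases hxv : x = v
      · subst hxv
        simp only [← hrow2, h1, hxu, hv.ne']; decide
      rw [hrow1 x hxu hxv]
      simp [hxu, hxv, zmod_two_add_self]
    · rw [map_add, hpush, h.push_path hu.ne' hv.ne, add_zero]

end IsFold

end Folds

/-! ### Folds that are injective on the cycle space, and their effect on blocks and frames. -/

noncomputable section Folds

set_option linter.unusedSectionVars false

open scoped Classical

variable {V W : Type*} [Fintype V] [Fintype W]

namespace IsFold

variable {G : SimpleGraph V} {H : SimpleGraph W} {π : V → W} {u v w : V} {L : ℕ}

theorem map_cycleSpace (h : IsFold G H π u v) (hu : G.Adj u w) (hv : G.Adj w v) :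
    (cycleSpace G).map (push π) = cycleSpace H := by
  apply le_antisymm
  · rintro _ ⟨f, hf, rfl⟩
    exact h.push_mem hf
  · intro g hg
    obtain ⟨f, hf, e⟩ := h.exists_push_eq hu hv hg
    exact ⟨f, hf, e⟩

theorem finrank_le (h : IsFold G H π u v) (hu : G.Adj u w) (hv : G.Adj w v) :
    finrank (ZMod 2) (cycleSpace H) ≤ finrank (ZMod 2) (cycleSpace G) := by
  rw [← h.map_cycleSpace hu hv]
  exact Submodule.finrank_map_le _ _

theorem finrank_lt (h : IsFold G H π u v) (hu : G.Adj u w) (hv : G.Adj w v)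
    {f : V → V → ZMod 2} (hf : f ∈ cycleSpace G) (hf0 : f ≠ 0) (hpf : push π f = 0) :
    finrank (ZMod 2) (cycleSpace H) < finrank (ZMod 2) (cycleSpace G) := by
  rw [← h.map_cycleSpace hu hv]
  have h1 := LinearMap.finrank_range_add_finrank_ker ((push π).domRestrict (cycleSpace G))
  rw [LinearMap.range_domRestrict] at h1
  have h2 : 0 < finrank (ZMod 2) (LinearMap.ker ((push π).domRestrict (cycleSpace G))) := by
    rw [Module.finrank_pos_iff_exists_ne_zero]
    refine ⟨⟨⟨f, hf⟩, by simpa using hpf⟩, fun h0 => hf0 ?_⟩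
    simpa using h0
  omega

/-- Otherwise the triangle on `u`, `v`, `w` would be a nonzero element of the kernel. -/
theorem not_adj (h : IsFold G H π u v) (hu : G.Adj u w) (hv : G.Adj w v)
    (hinj : ∀ f ∈ cycleSpace G, push π f = 0 → f = 0) : ¬ G.Adj u v := by
  intro huv
  have h1 := hinj _ (chain_mem (.cons huv (.cons hv.symm (.cons hu.symm .nil)))) (by
    simp only [chain, add_zero, map_add, h.push_edgeMat_self, zero_add]
    rw [← map_add, edgeMat_swap v, edgeMat_swap w u, add_comm]
    exact h.push_path hu.ne' hv.ne)
  have h2 := congrFun (congrFun h1 u) v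
  have hn := h.ne
  have hun := hu.ne
  have hvn := hv.ne
  simp [chain, edgeMat, hn, hn.symm, hun, hvn.symm] at h2

/-- A second common neighbour would give a 4-cycle in the kernel. -/
theorem eq_of_common (h : IsFold G H π u v) (hu : G.Adj u w) (hv : G.Adj w v)
    (hinj : ∀ f ∈ cycleSpace G, push π f = 0 → f = 0) {y : V} (hu' : G.Adj u y)
    (hv' : G.Adj y v) : y = w := by
  by_contra hne
  have h1 := hinj _ (chain_mem (.cons hu (.cons hv (.cons hv'.symm (.cons hu'.symm .nil))))) (by
    simp only [chain, add_zero]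
    rw [← add_assoc, map_add, h.push_path hu.ne' hv.ne, zero_add, edgeMat_swap v, edgeMat_swap y u,
      add_comm]
    exact h.push_path hu'.ne' hv'.ne)
  have h2 := congrFun (congrFun h1 u) w
  have hn := h.ne
  have hun := hu.ne
  have hvn := hv.ne
  simp [chain, edgeMat, hn, hvn, hun, hun.symm, Ne.symm hne] at h2

section Inj

variable (h : IsFold G H π u v) (hu : G.Adj u w) (hv : G.Adj w v)
    (hinj : ∀ f ∈ cycleSpace G, push π f = 0 → f = 0)

include h hu hv hinj

theorem eq_or_of_map_eq {x y x' y' : V} (hxy : G.Adj x y) (hxy' : G.Adj x' y') (hx : π x = π x')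
    (hy : π y = π y') : (x = x' ∧ y = y') ∨
      ((x = u ∧ x' = v ∨ x = v ∧ x' = u) ∧ y = w ∧ y' = w) ∨
      (x = w ∧ x' = w ∧ (y = u ∧ y' = v ∨ y = v ∧ y' = u)) := by
  have h1 := h.not_adj hu hv hinj
  have h2 : ∀ y, G.Adj u y → G.Adj v y → y = w := fun y hy hy' =>
    h.eq_of_common hu hv hinj hy hy'.symm
  have h3 := hxy.symm
  have h4 := hxy'.symm
  have h5 := fun h : G.Adj v u => h1 h.symm
  have h6 := G.irrefl (v := u)
  have h7 := G.irrefl (v := v)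
  rcases h.eq_or _ _ hx with e1 | ⟨e1, e2⟩ | ⟨e1, e2⟩ <;>
    rcases h.eq_or _ _ hy with e3 | ⟨e3, e4⟩ | ⟨e3, e4⟩ <;> grind

/-- Only `uw` and `vw` are merged, so the two sides can differ only there, and `hfg` says that the
cross terms of `(f u w + f v w) * (g u w + g v w)` cancel. -/
theorem push_mul {f g : V → V → ZMod 2} (hf : f ∈ cycleSpace G) (hg : g ∈ cycleSpace G)
    (hfg : f u w * g v w + f v w * g u w = 0) : push π (f * g) = push π f * push π g := by
  have hs : ∀ x y, (f * g) x y = (f * g) y x := fun x y => by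
    simp [symm_of_mem hf x, symm_of_mem hg x]
  have left : ∀ y, y ≠ u → y ≠ v →
      push π (f * g) (π u) (π y) = push π f (π u) (π y) * push π g (π u) (π y) := by
    intro y hyu hyv
    simp only [h.push_apply_left _ hyu hyv, Pi.mul_apply]
    by_cases hyw : y = w
    · subst hyw
      linear_combination -hfg
    · by_cases hy : G.Adj u y
      · have hy' : ¬ G.Adj v y := fun h' => hyw (h.eq_of_common hu hv hinj hy h'.symm)
        simp [eq_zero_of_mem hf hy', eq_zero_of_mem hg hy']
      · simp [eq_zero_of_mem hf hy, eq_zero_of_mem hg hy]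
  have cases : ∀ x, π x = π u ∨ (x ≠ u ∧ x ≠ v) := by
    intro x
    by_cases h1 : x = u
    · exact Or.inl (by rw [h1])
    by_cases h2 : x = v
    · exact Or.inl (by rw [h2, h.map_eq])
    exact Or.inr ⟨h1, h2⟩
  funext a b
  obtain ⟨x, rfl⟩ := h.surj a
  obtain ⟨y, rfl⟩ := h.surj b
  rw [Pi.mul_apply, Pi.mul_apply]
  rcases cases x with hx | ⟨hxu, hxv⟩ <;> rcases cases y with hy | ⟨hyu, hyv⟩
  · rw [hx, hy, push_diag π hs (fun x => by simp [eq_zero_of_mem hf G.irrefl]),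
      push_diag π hf.1 (fun x => eq_zero_of_mem hf G.irrefl), zero_mul]
  · rw [hx, left y hyu hyv]
  · rw [hy, push_symm π hs, left x hxu hxv, push_symm π hf.1, push_symm π hg.1]
  · simp only [h.push_apply _ hxu hxv hyu hyv, Pi.mul_apply]

theorem push_ne_zero {f : V → V → ZMod 2} (hf : f ∈ cycleSpace G) (hfw : f u w * f v w = 0)
    {x y : V} (hxy : f x y ≠ 0) : push π f (π x) (π y) ≠ 0 := by
  rw [BipartiteMinors.push_apply, Finset.sum_eq_single x, Finset.sum_eq_single y]
  · exact hxy
  · intro y' hy' hne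
    by_contra h'
    have h1 := h.eq_or_of_map_eq hu hv hinj (adj_of_mem hf hxy) (adj_of_mem hf h') rfl
      (by simpa [eq_comm] using hy')
    have h2 := symm_of_mem hf w
    rcases zmod_two_cases (f u w) with e | e <;> rcases zmod_two_cases (f v w) with e' | e' <;>
      grind
  · simp
  · intro x' hx' hne
    refine Finset.sum_eq_zero fun y' hy' => ?_
    by_contra h'
    have h1 := h.eq_or_of_map_eq hu hv hinj (adj_of_mem hf hxy) (adj_of_mem hf h')
      (by simpa [eq_comm] using hx') (by simpa [eq_comm] using hy')
    have h2 := symm_of_mem hf w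
    rcases zmod_two_cases (f u w) with e | e <;> rcases zmod_two_cases (f v w) with e' | e' <;>
      grind
  · simp

/-- An element that misses `uw` or `vw` has no two edges merged, so none of its edges is lost.
Applied to the snout, this keeps it from becoming shorter. -/
theorem card_support_le {f : V → V → ZMod 2} (hf : f ∈ cycleSpace G) (hfw : f u w * f v w = 0) :
    (Finset.univ.filter fun e : V × V => f e.1 e.2 ≠ 0).card ≤
      (Finset.univ.filter fun e : W × W => push π f e.1 e.2 ≠ 0).card := by
  refine Finset.card_le_card_of_injOn (Prod.map π π) ?_ ?_
  · rintro ⟨x, y⟩ hxy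
    simp only [Finset.coe_filter, Finset.mem_univ, true_and, Set.mem_ofPred_eq] at hxy
    simp only [Prod.map_apply, Finset.coe_filter, Finset.mem_univ, true_and, Set.mem_ofPred_eq]
    exact h.push_ne_zero hu hv hinj hf hfw hxy
  · rintro ⟨x, y⟩ hxy ⟨x', y'⟩ hxy' heq
    simp only [Finset.coe_filter, Finset.mem_univ, true_and, Set.mem_ofPred_eq] at hxy hxy'
    simp only [Prod.map_apply, Prod.mk.injEq] at heq
    have h1 := h.eq_or_of_map_eq hu hv hinj (adj_of_mem hf hxy) (adj_of_mem hf hxy') heq.1 heq.2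
    have h2 := symm_of_mem hf w
    rcases zmod_two_cases (f u w) with e | e <;> rcases zmod_two_cases (f v w) with e' | e' <;>
      grind

theorem isTrapped_of_block (hr : finrank (ZMod 2) (cycleSpace G) ≤ 3) {x : V → V → ZMod 2}
    (hx : IsBlock G x) (hxw : x u w = x v w)
    (hxf : ∀ f ∈ cycleSpace G, x u w = 1 → f u w = f v w) : IsTrapped H L := by
  refine Or.inr (Or.inl ⟨(h.finrank_le hu hv).trans hr, push π x, h.push_mem hx.1,
    fun h0 => hx.2.1 (hinj x hx.1 h0), fun g hg => ?_⟩)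
  obtain ⟨f, hf, rfl⟩ := h.exists_push_eq hu hv hg
  rw [← h.push_mul hu hv hinj hx.1 hf]
  · rcases hx.2.2 f hf with e | e
    · left; rw [e, map_zero]
    · right; rw [e]
  · rcases zmod_two_cases (x u w) with e | e
    · rw [← hxw, e]; simp
    · rw [← hxw, e, hxf f hf e]; simp [zmod_two_add_self]

theorem isTrapped_of_frame {A₁ A₂ S : V → V → ZMod 2} (hF : IsFrame G L A₁ A₂ S)
    (h₁ : A₁ u w = 1) (h₁' : A₁ v w = 1) : IsTrapped H L := by
  have h₂ : A₂ u w = 0 := by simpa [h₁] using congrFun (congrFun hF.mul_ears u) w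
  have h₂' : A₂ v w = 0 := by simpa [h₁'] using congrFun (congrFun hF.mul_ears v) w
  obtain ⟨p, q, hpq⟩ := hF.mul₁
  have hS : S u w = edgeMat p q u w := by simpa [h₁] using congrFun (congrFun hpq u) w
  have hS' : S v w = edgeMat p q v w := by simpa [h₁'] using congrFun (congrFun hpq v) w
  -- The ear contains both edges and shares only one edge with the snout.
  have hnot : S u w * S v w = 0 := by
    by_contra h0
    have e1 : s(u, w) = s(p, q) := edgeMat_ne_zero.1 (hS ▸ left_ne_zero_of_mul h0)
    have e2 : s(v, w) = s(p, q) := edgeMat_ne_zero.1 (hS' ▸ right_ne_zero_of_mul h0)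
    rw [← e2] at e1
    exact h.ne (by simpa [hv.ne] using e1)
  have hears : push π A₁ * push π A₂ = 0 := by
    rw [← h.push_mul hu hv hinj hF.mem₁ hF.mem₂ (by simp [h₂, h₂']), hF.mul_ears, map_zero]
  have hspan : ∀ g ∈ cycleSpace H, ∃ α β γ : ZMod 2,
      g = α • push π A₁ + β • push π A₂ + γ • push π S := by
    intro g hg
    obtain ⟨f, hf, rfl⟩ := h.exists_push_eq hu hv hg
    obtain ⟨α, β, γ, rfl⟩ := hF.span f hf
    exact ⟨α, β, γ, by simp⟩
  have hmap : ∀ {p q}, G.Adj p q → π p ≠ π q := by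
    intro p q hadj heq
    have := h.not_adj hu hv hinj
    rcases h.eq_or _ _ heq with rfl | ⟨rfl, rfl⟩ | ⟨rfl, rfl⟩
    · exact G.irrefl hadj
    · exact this hadj
    · exact this hadj.symm
  have hedge : ∀ {A : V → V → ZMod 2}, A ∈ cycleSpace G → (∃ p q, A * S = edgeMat p q) →
      A u w * S v w + A v w * S u w = 0 → ∃ p q, push π A * push π S = edgeMat p q := by
    rintro A hA ⟨p, q, hpq⟩ hAS
    rw [← h.push_mul hu hv hinj hA hF.memS hAS, hpq]
    refine ⟨π p, π q, push_edgeMat (hmap (adj_of_mem hA (x := p) (y := q) fun h0 => ?_))⟩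
    have := congrFun (congrFun hpq p) q
    rw [edgeMat_self, Pi.mul_apply, Pi.mul_apply, h0, zero_mul] at this
    exact zero_ne_one this
  -- By `hnot` the sum vanishes exactly when the snout avoids both edges; then the frame persists.
  -- Otherwise it contains exactly one of them, which is the edge `pq` shared with the ear.
  by_cases hsum : S u w + S v w = 0
  · refine Or.inr (Or.inr ⟨push π A₁, push π A₂, push π S, h.push_mem hF.mem₁, h.push_mem hF.mem₂,
      h.push_mem hF.memS, hears, ?_, ?_, ?_, hspan⟩)
    · exact hedge hF.mem₁ hF.mul₁ (by rw [h₁, h₁', one_mul, one_mul, add_comm, hsum])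
    · exact hedge hF.mem₂ hF.mul₂ (by rw [h₂, h₂', zero_mul, zero_mul, add_zero])
    · exact hF.card.trans (h.card_support_le hu hv hinj hF.memS hnot)
  · have hzero : push π A₁ (π u) (π w) = 0 := by
      rw [h.push_apply_left _ hu.ne' hv.ne, h₁, h₁']; rfl
    have hpqw : s(p, q) = s(u, w) ∨ s(p, q) = s(v, w) := by
      by_contra! hcon
      apply hsum
      rw [hS, hS']
      simp [edgeMat, hcon.1.symm, hcon.2.symm]
    -- The shared edge has become the image of `uw`, where the two edges of the ear cancel. Hence
    -- the image of the ear is disjoint from both other generators, that is, a block.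
    have hA₁S : push π A₁ * push π S = 0 := by
      funext a b
      by_contra h0
      have hA := left_ne_zero_of_mul h0
      have hB := right_ne_zero_of_mul h0
      obtain ⟨x, y, rfl, rfl, hxy⟩ := BipartiteMinors.push_ne_zero hA
      obtain ⟨x', y', hx, hy, hxy'⟩ := BipartiteMinors.push_ne_zero hB
      have hAsymm := push_symm π hF.mem₁.1 (π u) (π w)
      have hmapuv := h.map_eq
      have key : (π x = π u ∧ π y = π w) ∨ (π x = π w ∧ π y = π u) := by
        rcases h.eq_or_of_map_eq hu hv hinj (adj_of_mem hF.mem₁ hxy) (adj_of_mem hF.memS hxy')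
          hx.symm hy.symm with ⟨rfl, rfl⟩ | e | e
        · have e1 : s(x, y) = s(p, q) := by
            rw [← edgeMat_ne_zero, ← hpq]
            exact mul_ne_zero hxy hxy'
          rw [← e1, Sym2.eq_iff, Sym2.eq_iff] at hpqw
          grind
        · grind
        · grind
      rcases key with ⟨e1, e2⟩ | ⟨e1, e2⟩
      · rw [e1, e2] at hA; exact hA hzero
      · rw [e1, e2] at hA; exact hA (hAsymm.symm.trans hzero)
    refine Or.inr (Or.inl ⟨(h.finrank_le hu hv).trans hF.finrank_le, push π A₁,
      h.push_mem hF.mem₁, fun h0 => ?_, fun g hg => ?_⟩)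
    · have := hinj _ hF.mem₁ h0
      rw [this] at h₁
      exact zero_ne_one h₁
    · obtain ⟨α, β, γ, rfl⟩ := hspan g hg
      have hsq : push π A₁ * push π A₁ = push π A₁ := by
        funext a b
        rw [Pi.mul_apply, Pi.mul_apply]
        rcases zmod_two_cases (push π A₁ a b) with e | e <;> rw [e] <;> rfl
      simp only [mul_add, mul_smul_comm, hears, hA₁S, hsq, smul_zero, add_zero]
      rcases zmod_two_cases α with rfl | rfl <;> simp

end Inj

end IsFold

end Folds

/-! ### Induced non-separating cycles of a frame. -/

noncomputable section Cycles

set_option linter.unusedSectionVars false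

open scoped Classical

section Classification

variable {V : Type*} [Fintype V] {G : SimpleGraph V} {L : ℕ} {A₁ A₂ S : V → V → ZMod 2}

theorem ne_zero_of_mul_eq_edgeMat {A B : V → V → ZMod 2} {p q : V} (h : A * B = edgeMat p q) :
    A p q = 1 ∧ B p q = 1 := by
  have h1 : A p q * B p q = 1 := by
    rw [← edgeMat_self p q, ← h]; rfl
  revert h1
  generalize A p q = r
  generalize B p q = s
  revert r s; decide

theorem mem_edges_of_chain_ne_zero {a b : V} {c : G.Walk a b} {x y : V} (h : chain c x y ≠ 0) :
    s(x, y) ∈ c.edges := by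
  by_contra h'; exact h (chain_eq_zero c h')

/-- In a frame, an edge of an ear that is not on the snout leaves the common edge at either end. -/
theorem exists_ear_edge {A B : V → V → ZMod 2} {p q : V} (hA : A ∈ cycleSpace G)
    (h : A * B = edgeMat p q) : ∃ r, r ≠ q ∧ A p r = 1 ∧ B p r = 0 := by
  have h1 := (ne_zero_of_mul_eq_edgeMat h).1
  obtain ⟨r, hr, hr'⟩ := exists_ne_of_mem hA (x := p) (y := q) (by rw [h1]; decide)
  have h2 : A p r = 1 := (zmod_two_cases _).resolve_left hr'
  refine ⟨r, hr, h2, ?_⟩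
  have h3 : A p r * B p r = edgeMat p q p r := by rw [← h]; rfl
  rw [h2, one_mul] at h3
  rw [h3]
  by_contra h4
  have h5 := (adj_of_mem hA (x := p) (y := q) (by rw [h1]; decide)).ne
  exact hr (by simpa [h5] using edgeMat_ne_zero.1 h4)

/-- If `A` and `X` are disjoint, the cycle contains `A` and hence equals it. If they share just the
edge `pq`, that edge cancels, while another edge of `A` remains at each of its ends: `pq` would be a
chord. -/
theorem chain_eq_of_summand {a : V} {c : G.Walk a a} (hc : c.IsCycle) (hch : c.IsChordless)
    {A X : V → V → ZMod 2} (hA : A ∈ cycleSpace G) (hA0 : A ≠ 0)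
    (hAX : A * X = 0 ∨ ∃ p q, A * X = edgeMat p q) (h : chain c = A + X) : chain c = A := by
  rcases hAX with h0 | ⟨p, q, hpq⟩
  · refine ((eq_zero_or_eq_chain hc hA fun x y hxy => ?_).resolve_left hA0).symm
    have h1 : A x y * X x y = 0 := by
      rw [← Pi.mul_apply, ← Pi.mul_apply, h0]; rfl
    have h2 : X x y = 0 := (mul_eq_zero.1 h1).resolve_left hxy
    exact mem_edges_of_chain_ne_zero (by rwa [h, Pi.add_apply, Pi.add_apply, h2, add_zero])
  · exfalso
    have h1 := ne_zero_of_mul_eq_edgeMat hpq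
    have hsupp : ∀ p q, A * X = edgeMat p q → p ∈ c.support := by
      intro p q hpq
      obtain ⟨r, -, hr, hr'⟩ := exists_ear_edge hA hpq
      refine c.fst_mem_support_of_mem_edges (u := r) (mem_edges_of_chain_ne_zero ?_)
      rw [h, Pi.add_apply, Pi.add_apply, hr, hr']
      decide
    have h2 := hch.mem_edges (hsupp p q hpq) (hsupp q p (by rw [hpq, edgeMat_swap]))
      (adj_of_mem hA (by rw [h1.1]; decide))
    have h3 := chain_eq_one hc.isCircuit.isTrail h2
    rw [h, Pi.add_apply, Pi.add_apply, h1.1, h1.2] at h3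
    exact absurd h3 (by decide)

theorem IsFrame.ne_zero (hF : IsFrame G L A₁ A₂ S) : A₁ ≠ 0 := by
  obtain ⟨p, q, h⟩ := hF.mul₁
  intro h0
  have := (ne_zero_of_mul_eq_edgeMat h).1
  rw [h0] at this
  exact zero_ne_one this

/-- The induced cycles of a frame are the ears and the snout. -/
theorem IsFrame.chain_cases (hF : IsFrame G L A₁ A₂ S) {a : V} {c : G.Walk a a}
    (hc : c.IsCycle) (hch : c.IsChordless) : chain c = A₁ ∨ chain c = A₂ ∨ chain c = S := by
  have main : ∀ {A₁ A₂}, IsFrame G L A₁ A₂ S → ∀ β γ : ZMod 2,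
      chain c = A₁ + (β • A₂ + γ • S) → chain c = A₁ := by
    intro A₁ A₂ hF β γ h
    refine chain_eq_of_summand hc hch hF.mem₁ hF.ne_zero ?_ h
    rw [mul_add, mul_smul_comm, mul_smul_comm, hF.mul_ears, smul_zero, zero_add]
    rcases zmod_two_cases γ with rfl | rfl
    · left; rw [zero_smul]
    · right; rw [one_smul]; exact hF.mul₁
  obtain ⟨α, β, γ, h⟩ := hF.span _ (chain_mem c)
  rcases zmod_two_cases α with rfl | rfl
  · rcases zmod_two_cases β with rfl | rfl
    · rcases zmod_two_cases γ with rfl | rfl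
      · exfalso
        cases c with
        | nil => exact Walk.not_isCycle_nil hc
        | @cons _ v _ hadj p =>
          have := chain_eq_one hc.isCircuit.isTrail (x := a) (y := v) (by simp)
          rw [h] at this
          simp at this
      · right; right; simpa using h
    · right; left
      exact main hF.symm 0 γ (by simpa using h)
  · left
    exact main hF β γ (by rw [h, one_smul, add_assoc])

end Classification

section Separation

universe u

variable {V : Type u} [Fintype V] {G : SimpleGraph V} {L : ℕ} {A₁ A₂ S : V → V → ZMod 2}

/-- Since the component of the cycle still has the vertex `r` outside it, inclusion is onto on
components; by the count of components it is then also injective. -/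
theorem reachable_of_isNonSeparating {a : V} {c : G.Walk a a} (hns : IsNonSeparating c)
    {p r s : V} (hp : p ∈ c.support) (hr : r ∉ c.support) (hs : s ∉ c.support)
    (hpr : G.Adj p r) (hrs : G.Reachable r s) :
    (G.induce {x | x ∉ c.support}).Reachable ⟨r, hr⟩ ⟨s, hs⟩ := by
  let F : (G.induce {x | x ∉ c.support}).ConnectedComponent → G.ConnectedComponent :=
    ConnectedComponent.map (Embedding.induce _).toHom
  have hF : Function.Surjective F := by
    intro K
    induction K using ConnectedComponent.ind with
    | h x =>
    by_cases hx : x ∈ c.support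
    · refine ⟨(G.induce {x | x ∉ c.support}).connectedComponentMk ⟨r, hr⟩, ?_⟩
      have h1 : G.Reachable a x := ⟨c.takeUntil x hx⟩
      have h2 : G.Reachable a p := ⟨c.takeUntil p hp⟩
      exact ConnectedComponent.sound ((hpr.reachable.symm.trans h2.symm).trans h1)
    · exact ⟨(G.induce {x | x ∉ c.support}).connectedComponentMk ⟨x, hx⟩, rfl⟩
  have hcard : Nat.card (G.induce {x | x ∉ c.support}).ConnectedComponent ≤
      Nat.card G.ConnectedComponent := by
    unfold Nat.card
    exact Cardinal.toNat_le_toNat hns (Cardinal.mk_lt_aleph0)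
  have hinj : Function.Injective F := by
    have := Fintype.ofFinite G.ConnectedComponent
    have := Fintype.ofFinite (G.induce {x | x ∉ c.support}).ConnectedComponent
    rw [Nat.card_eq_fintype_card, Nat.card_eq_fintype_card] at hcard
    exact ((Fintype.bijective_iff_surjective_and_card F).2
      ⟨hF, le_antisymm hcard (Fintype.card_le_of_surjective F hF)⟩).1
  exact ConnectedComponent.exact (hinj (ConnectedComponent.sound hrs))

/-- The snout of a frame separates the ears. -/
theorem IsFrame.chain_ne_snout (hF : IsFrame G L A₁ A₂ S) {a : V} {c : G.Walk a a}
    (hc : c.IsCycle) (hch : c.IsChordless) (hns : IsNonSeparating c) : chain c ≠ S := by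
  intro hcS
  have hsupp : ∀ {A : V → V → ZMod 2} {p q : V}, A * S = edgeMat p q → p ∈ c.support := by
    intro A p q h
    refine c.fst_mem_support_of_mem_edges (u := q) (mem_edges_of_chain_ne_zero ?_)
    rw [hcS, (ne_zero_of_mul_eq_edgeMat h).2]; decide
  have hout : ∀ {A : V → V → ZMod 2} {p q : V}, A ∈ cycleSpace G → A * S = edgeMat p q →
      ∃ r, A p r = 1 ∧ r ∉ c.support := by
    intro A p q hA h
    obtain ⟨r, hr, h1, h0⟩ := exists_ear_edge hA h
    refine ⟨r, h1, fun hrc => ?_⟩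
    have h2 := hch.mem_edges (hsupp h) hrc (adj_of_mem hA (by rw [h1]; decide))
    have h3 := chain_eq_one hc.isCircuit.isTrail h2
    rw [hcS, h0] at h3
    exact zero_ne_one h3
  obtain ⟨p₁, q₁, h₁⟩ := hF.mul₁
  obtain ⟨p₂, q₂, h₂⟩ := hF.mul₂
  have h₁' : A₁ * S = edgeMat q₁ p₁ := by rw [h₁, edgeMat_swap]
  obtain ⟨r₁, hr₁, hr₁c⟩ := hout hF.mem₁ h₁
  obtain ⟨r₂, hr₂, hr₂c⟩ := hout hF.mem₂ h₂
  obtain ⟨t, ht, htc⟩ := hout hF.mem₁ h₁'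
  have hp₁ := hsupp h₁
  have hp₂ := hsupp h₂
  have hq₁ := hsupp h₁'
  have adj₁ : G.Adj p₁ r₁ := adj_of_mem hF.mem₁ (by rw [hr₁]; decide)
  have adj₂ : G.Adj p₂ r₂ := adj_of_mem hF.mem₂ (by rw [hr₂]; decide)
  have hpq : p₁ ≠ q₁ :=
    (adj_of_mem hF.mem₁ (by rw [(ne_zero_of_mul_eq_edgeMat h₁).1]; decide)).ne
  let d : G.Walk p₂ p₁ := (c.takeUntil p₂ hp₂).reverse.append (c.takeUntil p₁ hp₁)
  have hd : ∀ x y, x ∈ c.support → y ∉ c.support → s(x, y) ∉ d.edges := by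
    intro x y _ hy h
    simp only [d, Walk.edges_append, Walk.edges_reverse, List.mem_append, List.mem_reverse] at h
    rcases h with h | h
    · exact hy (c.snd_mem_support_of_mem_edges (c.edges_takeUntil_subset_edges hp₂ h))
    · exact hy (c.snd_mem_support_of_mem_edges (c.edges_takeUntil_subset_edges hp₁ h))
  have hreach : G.Reachable r₁ r₂ :=
    (adj₁.reachable.symm.trans ⟨d.reverse⟩).trans adj₂.reachable
  obtain ⟨e'⟩ := reachable_of_isNonSeparating hns hp₁ hr₁c hr₂c adj₁ hreach
  let e : G.Walk r₁ r₂ := e'.map (Embedding.induce _).toHom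
  have he : ∀ x y, x ∈ c.support → s(x, y) ∉ e.edges := by
    intro x y hx h
    have h3 := e.fst_mem_support_of_mem_edges h
    rw [show e.support = e'.support.map _ from Walk.support_map _ _, List.mem_map] at h3
    obtain ⟨z, -, hz⟩ := h3
    exact z.2 (show z.1 ∈ c.support from (show z.1 = x from hz) ▸ hx)
  -- If the snout were non-separating, this closed walk would leave it along the first ear at `p₁`,
  -- reach the second ear off the snout, and return along the snout. It uses the edge `p₁r₁` of the
  -- first ear but not `q₁t`, while `key` shows that an element of the span treats both alike.
  let k : G.Walk p₁ p₁ := .cons adj₁ (e.append (.cons adj₂.symm d))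
  have hk : ∀ x y, x ∈ c.support → y ∉ c.support → s(x, y) ≠ s(p₂, r₂) →
      chain k x y = edgeMat p₁ r₁ x y := by
    intro x y hx hy hne
    have : chain (e.append (.cons adj₂.symm d)) x y = 0 := by
      refine chain_eq_zero _ fun h => ?_
      rw [Walk.edges_append, List.mem_append, Walk.edges_cons, List.mem_cons] at h
      rcases h with h | h | h
      · exact he x y hx h
      · exact hne (h.trans Sym2.eq_swap)
      · exact hd x y hx hy h
    simp only [k, chain, Pi.add_apply, this, add_zero]
  have hne : ∀ x y, A₁ x y = 1 → s(x, y) ≠ s(p₂, r₂) := by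
    intro x y hxy h
    have h0 : A₁ x y * A₂ x y = 0 := by
      rw [← Pi.mul_apply, ← Pi.mul_apply, hF.mul_ears]; rfl
    rw [hxy, one_mul] at h0
    rcases Sym2.eq_iff.1 h with ⟨rfl, rfl⟩ | ⟨rfl, rfl⟩
    · rw [hr₂] at h0; exact one_ne_zero h0
    · rw [symm_of_mem hF.mem₂, hr₂] at h0; exact one_ne_zero h0
  have e1 : chain k p₁ r₁ = 1 := by
    rw [hk _ _ hp₁ hr₁c (hne _ _ hr₁), edgeMat_self]
  have e2 : chain k q₁ t = 0 := by
    rw [hk _ _ hq₁ htc (hne _ _ ht)]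
    by_contra h
    rcases Sym2.eq_iff.1 (edgeMat_ne_zero.1 h) with ⟨h, -⟩ | ⟨h, -⟩
    · exact hpq h.symm
    · exact hr₁c (h ▸ hq₁)
  obtain ⟨α, β, γ, hspan⟩ := hF.span _ (chain_mem k)
  have key : ∀ x y, A₁ x y = 1 → x ∈ c.support → y ∉ c.support → chain k x y = α := by
    intro x y hxy hx hy
    have hA₂ : A₁ x y * A₂ x y = 0 := by
      rw [← Pi.mul_apply, ← Pi.mul_apply, hF.mul_ears]; rfl
    have hS : S x y = 0 := by
      rw [← hcS]
      exact chain_eq_zero c fun h => hy (c.snd_mem_support_of_mem_edges h)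
    rw [hxy, one_mul] at hA₂
    rw [hspan]
    simp [hxy, hA₂, hS]
  rw [key _ _ hr₁ hp₁ hr₁c] at e1
  rw [key _ _ ht hq₁ htc] at e2
  exact zero_ne_one (e2.symm.trans e1)

/-- Admissible contractions preserve the trap. -/
theorem IsFold.isTrapped {W : Type*} [Fintype W] {H : SimpleGraph W} {π : V → W} {u v w a : V}
    (h : IsFold G H π u v) (hG : IsTrapped G L) {c : G.Walk a a} (hc : c.IsCycle)
    (hch : c.IsChordless) (hns : IsNonSeparating c) (hu : s(u, w) ∈ c.edges)
    (hv : s(w, v) ∈ c.edges) : IsTrapped H L := by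
  have hu' := c.adj_of_mem_edges hu
  have hv' := c.adj_of_mem_edges hv
  by_cases hinj : ∀ f ∈ cycleSpace G, push π f = 0 → f = 0
  swap
  · push Not at hinj
    obtain ⟨f, hf, h0, hne⟩ := hinj
    have h1 := h.finrank_lt hu' hv' hf hne h0
    have h2 := hG.finrank_le
    exact Or.inl (by omega)
  have cu : chain c u w = 1 := chain_eq_one hc.isCircuit.isTrail hu
  have cv : chain c v w = 1 := by
    rw [chain_symm]; exact chain_eq_one hc.isCircuit.isTrail hv
  rcases hG with hG | ⟨hr, x, hx⟩ | ⟨A₁, A₂, S, hF⟩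
  · exact Or.inl ((h.finrank_le hu' hv').trans hG)
  · rcases hx.2.2 _ (chain_mem c) with h0 | h0
    · have e1 : x u w = 0 := by simpa [cu] using congrFun (congrFun h0 u) w
      have e2 : x v w = 0 := by simpa [cv] using congrFun (congrFun h0 v) w
      exact h.isTrapped_of_block hu' hv' hinj hr hx (by rw [e1, e2])
        (fun f _ h1 => absurd (e1.symm.trans h1) zero_ne_one)
    -- The block lies inside the cycle, and a cycle supports only one nonzero element.
    · have hxc : x = chain c := by
        refine (eq_zero_or_eq_chain hc hx.1 fun y z hyz => ?_).resolve_left hx.2.1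
        refine mem_edges_of_chain_ne_zero (fun h1 => hyz ?_)
        rw [← h0, Pi.mul_apply, Pi.mul_apply, h1, mul_zero]
      refine h.isTrapped_of_block hu' hv' hinj hr hx (by rw [hxc, cu, cv]) fun f hf _ => ?_
      rcases hx.2.2 f hf with h1 | h1
      · have e1 : f u w = 0 := by simpa [hxc, cu] using congrFun (congrFun h1 u) w
        have e2 : f v w = 0 := by simpa [hxc, cv] using congrFun (congrFun h1 v) w
        rw [e1, e2]
      · have e1 : f u w = 1 := by simpa [hxc, cu] using congrFun (congrFun h1 u) w
        have e2 : f v w = 1 := by simpa [hxc, cv] using congrFun (congrFun h1 v) w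
        rw [e1, e2]
  · rcases hF.chain_cases hc hch with e | e | e
    · exact h.isTrapped_of_frame hu' hv' hinj hF (e ▸ cu) (e ▸ cv)
    · exact h.isTrapped_of_frame hu' hv' hinj hF.symm (e ▸ cu) (e ▸ cv)
    · exact absurd e (hF.chain_ne_snout hc hch hns)

end Separation

end Cycles

/-! ### Contractions as folds, and invariance under bipartite minors. -/

section Invariance

open scoped Classical

universe u

variable {V W : Type u}

/-- The quotient map of a contraction. -/
noncomputable def contractMap (U : Set V) (x : V) : Option {x : V // x ∉ U} :=
  if h : x ∈ U then none else some ⟨x, h⟩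

theorem contractMap_eq_none {U : Set V} {x : V} : contractMap U x = none ↔ x ∈ U := by
  unfold contractMap; split_ifs with h <;> simp [h]

theorem contractMap_eq_some {U : Set V} {x : V} {y : {x : V // x ∉ U}} :
    contractMap U x = some y ↔ x = y := by
  unfold contractMap
  split_ifs with h
  · simp only [false_iff]
    rintro rfl
    exact y.2 h
  · simp [Subtype.ext_iff]

theorem isFold_of_iso_contract [Fintype V] [Fintype W] {G : SimpleGraph V} {H : SimpleGraph W}
    {u v : V} (huv : u ≠ v) (e : H ≃g contract G {u, v}) :
    IsFold G H (fun x => e.symm (contractMap {u, v} x)) u v where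
  ne := huv
  map_eq := congrArg e.symm ((contractMap_eq_none.2 (by simp)).trans
    (contractMap_eq_none.2 (by simp)).symm)
  eq_or x y hxy := by
    have h1 := e.symm.injective hxy
    rcases hy' : contractMap {u, v} y with _ | z
    · rw [hy'] at h1
      have hx := contractMap_eq_none.1 h1
      have hy := contractMap_eq_none.1 hy'
      simp only [Set.mem_insert_iff, Set.mem_singleton_iff] at hx hy
      rcases hx with rfl | rfl <;> rcases hy with rfl | rfl <;> simp
    · rw [hy'] at h1
      exact Or.inl ((contractMap_eq_some.1 h1).trans (contractMap_eq_some.1 hy').symm)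
  surj a := by
    obtain ⟨b, rfl⟩ := e.symm.surjective a
    rcases b with _ | x
    · exact ⟨u, congrArg e.symm (contractMap_eq_none.2 (by simp))⟩
    · exact ⟨x, congrArg e.symm (contractMap_eq_some.2 rfl)⟩
  adj_iff a b := by
    obtain ⟨a, rfl⟩ := e.symm.surjective a
    obtain ⟨b, rfl⟩ := e.symm.surjective b
    rw [e.symm.map_adj_iff]
    simp only [e.symm.injective.eq_iff, ne_eq]
    rcases a with _ | x <;> rcases b with _ | y
    · simp [contract]
    · simp only [contractMap_eq_none, contractMap_eq_some, contract, reduceCtorEq,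
        not_false_eq_true, true_and]
      constructor
      · rintro ⟨a, ha, h⟩; exact ⟨a, y, ha, rfl, h⟩
      · rintro ⟨a, _, ha, rfl, h⟩; exact ⟨a, ha, h⟩
    · simp only [contractMap_eq_none, contractMap_eq_some, contract, reduceCtorEq,
        not_false_eq_true, true_and]
      constructor
      · rintro ⟨a, ha, h⟩; exact ⟨x, a, rfl, ha, h.symm⟩
      · rintro ⟨_, a, rfl, ha, h⟩; exact ⟨a, ha, h.symm⟩
    · simp only [contractMap_eq_some, contract, Option.some.injEq]
      constructor
      · intro h; exact ⟨fun h' => G.irrefl (h' ▸ h), x, y, rfl, rfl, h⟩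
      · rintro ⟨-, _, _, rfl, rfl, h⟩; exact h

/-- Every bipartite minor of a trapped graph is trapped. -/
theorem IsTrapped.of_isBipartiteMinor {H : SimpleGraph W} {G : SimpleGraph V} {L : ℕ}
    (h : IsBipartiteMinor H G) (hG : ∃ _ : Fintype V, IsTrapped G L) :
    ∃ _ : Fintype W, IsTrapped H L := by
  have sub : ∀ {V V' : Type u} {G : SimpleGraph V} {G' : SimpleGraph V'} {π : V' → V},
      Function.Injective π → (∀ x y, G'.Adj x y → G.Adj (π x) (π y)) →
      (∃ _ : Fintype V, IsTrapped G L) → ∃ _ : Fintype V', IsTrapped G' L := by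
    rintro V V' G G' π hπ hadj ⟨_, hG⟩
    have := Fintype.ofInjective π hπ
    exact ⟨this, hG.of_injective hπ hadj⟩
  induction h with
  | iso h =>
    obtain ⟨e⟩ := h
    exact sub e.injective (fun x y hxy => e.map_adj_iff.2 hxy) hG
  | step h _ ih =>
    apply ih
    rcases h with ⟨v, ⟨e⟩⟩ | ⟨s, -, ⟨e⟩⟩ | ⟨u, v, ⟨hne, w, a, c, hc, hch, hns, hu, hv⟩, ⟨e⟩⟩
    · exact sub (π := fun x => (e x).1) (Subtype.val_injective.comp e.injective)
        (fun x y hxy => e.map_adj_iff.2 hxy) hG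
    · exact sub e.injective
        (fun x y hxy => ((SimpleGraph.deleteEdges_adj).1 (e.map_adj_iff.2 hxy)).1) hG
    · obtain ⟨_, hG⟩ := hG
      have := Fintype.ofInjective e e.injective
      exact ⟨this, (isFold_of_iso_contract hne e).isTrapped hG hc hch hns hu hv⟩

end Invariance

/-! ### Cycle spaces of glued ears and of the snout. -/

noncomputable section Dogs

set_option linter.unusedSectionVars false

open scoped Classical

variable {V : Type*} [Fintype V]

/-- A matrix on `V`, extended by zero. -/
def extend {ι : Type*} (g : V → V → ZMod 2) : V ⊕ ι → V ⊕ ι → ZMod 2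
  | .inl a, .inl b => g a b
  | _, _ => 0

/-- The cycle that is glued on by `attachEar`. -/
def earMat (x y : V) (m : ℕ) : V ⊕ Fin (m - 2) → V ⊕ Fin (m - 2) → ZMod 2
  | .inl a, .inl b => edgeMat x y a b
  | .inr i, .inr j => if (pathGraph (m - 2)).Adj i j then 1 else 0
  | .inl a, .inr i => if (a = x ∧ i.val = 0) ∨ (a = y ∧ i.val + 1 = m - 2) then 1 else 0
  | .inr i, .inl a => if (a = x ∧ i.val = 0) ∨ (a = y ∧ i.val + 1 = m - 2) then 1 else 0

/-- The vertices of the glued cycle, in cyclic order. -/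
def earVertex (x y : V) (m i : ℕ) : V ⊕ Fin (m - 2) :=
  if i = 0 then .inl x else if h : i - 1 < m - 2 then .inr ⟨i - 1, h⟩ else .inl y

theorem sum_eq_zero_of_two {f : V → ZMod 2} {a b : V} (hab : a ≠ b)
    (h : ∀ z, f z = if z = a ∨ z = b then 1 else 0) : ∑ z, f z = 0 := by
  rw [Finset.sum_eq_add a b hab]
  · simp only [h, true_or, or_true, if_true]; rfl
  · rintro c - ⟨hca, hcb⟩
    rw [h, if_neg (by tauto)]
  · simp
  · simp

section Ear

variable {G : SimpleGraph V} {x y : V} {m : ℕ}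

theorem earVertex_succ (i : Fin (m - 2)) : earVertex x y m (i.val + 1) = .inr i := by
  simp [earVertex]

/-- The new vertex `inr i` sits at position `i + 1` of the glued cycle, so its neighbours are at
positions `i` and `i + 2`. -/
theorem attachEar_adj_inr (i : Fin (m - 2)) (z : V ⊕ Fin (m - 2)) :
    (attachEar G x y m).Adj (.inr i) z ↔
      z = earVertex x y m i.val ∨ z = earVertex x y m (i.val + 2) := by
  have hi := i.2
  rcases z with a | j
  · simp only [attachEar, earVertex]
    split_ifs <;> simp <;> first | omega | grind
  · have hj := j.2
    simp only [attachEar, earVertex, pathGraph_adj]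
    split_ifs <;> first | contradiction | (simp [Fin.ext_iff]; omega)

theorem earVertex_ne (hxy : x ≠ y) (i : Fin (m - 2)) :
    earVertex x y m i.val ≠ earVertex x y m (i.val + 2) := by
  have hi := i.2
  simp only [earVertex]
  split_ifs <;> simp [hxy] <;> omega

theorem earMat_inr (i : Fin (m - 2)) (z : V ⊕ Fin (m - 2)) :
    earMat x y m (.inr i) z = if (attachEar G x y m).Adj (.inr i) z then 1 else 0 := by
  rcases z with a | j
  · simp only [earMat, attachEar]; congr
  · simp only [earMat, attachEar]; congr

theorem earMat_symm (z z' : V ⊕ Fin (m - 2)) : earMat x y m z z' = earMat x y m z' z := by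
  rcases z with a | i <;> rcases z' with b | j
  · exact edgeMat_symm _ _ _ _
  · rfl
  · rfl
  · simp only [earMat, adj_comm]

theorem earMat_mem (hxy : G.Adj x y) (hm : 3 ≤ m) : earMat x y m ∈ cycleSpace (attachEar G x y m) := by
  refine ⟨earMat_symm, fun z z' h => ?_, fun z => ?_⟩
  · have key : ∀ i z, earMat x y m (.inr i) z ≠ 0 → (attachEar G x y m).Adj (.inr i) z := by
      intro i z h
      rw [earMat_inr (G := G)] at h
      by_contra h'
      exact h (if_neg h')
    rcases z with a | i
    · rcases z' with b | j
      · rcases Sym2.eq_iff.1 (edgeMat_ne_zero.1 h) with ⟨rfl, rfl⟩ | ⟨rfl, rfl⟩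
        · exact hxy
        · exact hxy.symm
      · rw [earMat_symm] at h
        exact (key _ _ h).symm
    · exact key _ _ h
  · rcases z with a | i
    · rw [Fintype.sum_sum_type]
      simp only [earMat, sum_edgeMat hxy.ne]
      by_cases hax : a = x
      · subst hax
        rw [Finset.sum_eq_single ⟨0, by omega⟩]
        · simp [hxy.ne]; decide
        · intro i _ hi
          have : i.val ≠ 0 := fun h => hi (Fin.ext h)
          simp [hxy.ne, this]
        · simp
      · by_cases hay : a = y
        · subst hay
          rw [Finset.sum_eq_single ⟨m - 3, by omega⟩]
          · have : m - 3 + 1 = m - 2 := by omega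
            simp [hax, this]; decide
          · intro i _ hi
            have : i.val + 1 ≠ m - 2 := fun h => hi (Fin.ext (by simp; omega))
            simp [hax, this]
          · simp
        · simp [hax, hay]
    · refine sum_eq_zero_of_two (earVertex_ne hxy.ne i) fun z => ?_
      rw [earMat_inr (G := G)]
      simp only [attachEar_adj_inr]
      congr

theorem extend_mem {g : V → V → ZMod 2} (hg : g ∈ cycleSpace G) :
    extend g ∈ cycleSpace (attachEar G x y m) := by
  refine ⟨fun z z' => ?_, fun z z' h => ?_, fun z => ?_⟩
  · rcases z with a | i <;> rcases z' with b | j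
    · exact symm_of_mem hg a b
    all_goals rfl
  · rcases z with a | i <;> rcases z' with b | j <;> simp only [extend, ne_eq, not_true] at h
    exact adj_of_mem hg h
  · rw [Fintype.sum_sum_type]
    rcases z with a | i <;> simp [extend, row_sum_of_mem hg]

theorem earVertex_const (hxy : x ≠ y) {f : V ⊕ Fin (m - 2) → V ⊕ Fin (m - 2) → ZMod 2}
    (hf : f ∈ cycleSpace (attachEar G x y m)) {i : ℕ} (hi : i ≤ m - 2) :
    f (earVertex x y m i) (earVertex x y m (i + 1)) =
      f (earVertex x y m 0) (earVertex x y m 1) := by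
  induction i with
  | zero => rfl
  | succ i ih =>
    have h1 := eq_of_two_neighbors hf (earVertex_ne hxy ⟨i, hi⟩)
      (fun z hz => (attachEar_adj_inr (G := G) ⟨i, hi⟩ z).1 hz)
    rw [← ih (by omega), symm_of_mem hf (earVertex x y m i),
      earVertex_succ (x := x) (y := y) (⟨i, hi⟩ : Fin (m - 2)), h1]

/-- Gluing on an ear adds one generator to the cycle space. -/
theorem exists_eq_extend_add (hxy : G.Adj x y) (hm : 3 ≤ m)
    {f : V ⊕ Fin (m - 2) → V ⊕ Fin (m - 2) → ZMod 2}
    (hf : f ∈ cycleSpace (attachEar G x y m)) :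
    ∃ α : ZMod 2, ∃ g ∈ cycleSpace G, f = extend g + α • earMat x y m := by
  -- The value on the first ear edge is the value on all edges through new vertices; removing that
  -- multiple of the ear leaves an element supported on `G`.
  let α := f (earVertex x y m 0) (earVertex x y m 1)
  let f' := f + α • earMat x y m
  have hf' : f' ∈ cycleSpace (attachEar G x y m) :=
    add_mem hf (Submodule.smul_mem _ _ (earMat_mem hxy hm))
  have h0 : f' (earVertex x y m 0) (earVertex x y m 1) = 0 := by
    have h1 : earMat x y m (earVertex x y m 0) (earVertex x y m 1) = 1 := by
      have : 0 < m - 2 := by omega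
      simp [earVertex, earMat, this]
    simp only [f', Pi.add_apply, Pi.smul_apply, h1, smul_eq_mul, mul_one]
    exact zmod_two_add_self _
  have hz : ∀ i z, f' (.inr i) z = 0 := by
    intro i z
    by_contra h
    have hi := i.2
    rcases (attachEar_adj_inr i z).1 (adj_of_mem hf' h) with rfl | rfl
    · apply h
      rw [symm_of_mem hf', ← earVertex_succ (x := x) (y := y) i,
        earVertex_const hxy.ne hf' (by omega), h0]
    · apply h
      rw [← earVertex_succ (x := x) (y := y) i, earVertex_const hxy.ne hf' (by omega), h0]
  refine ⟨α, fun a b => f' (.inl a) (.inl b), ⟨fun a b => symm_of_mem hf' _ _,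
    fun a b h => adj_of_mem hf' h, fun a => ?_⟩, ?_⟩
  · have h1 := row_sum_of_mem hf' (.inl a)
    rw [Fintype.sum_sum_type] at h1
    rw [← h1]
    simp [symm_of_mem hf' (.inl a) (.inr _), hz]
  · have h1 : extend (fun a b => f' (.inl a) (.inl b)) = f' := by
      funext z z'
      rcases z with a | i
      · rcases z' with b | j
        · rfl
        · rw [symm_of_mem hf', hz]; rfl
      · rw [hz]; rfl
    rw [h1, add_assoc, mat_add_self, add_zero]

end Ear

theorem card_support (g : V → V → ZMod 2) :
    (Finset.univ.filter fun e : V × V => g e.1 e.2 ≠ 0).card =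
      ∑ x, ∑ y, if g x y ≠ 0 then 1 else 0 := by
  rw [Finset.card_filter, Fintype.sum_prod_type]

theorem card_support_extend {ι : Type*} [Fintype ι] (g : V → V → ZMod 2) :
    (Finset.univ.filter fun e : (V ⊕ ι) × (V ⊕ ι) => extend g e.1 e.2 ≠ 0).card =
      (Finset.univ.filter fun e : V × V => g e.1 e.2 ≠ 0).card := by
  rw [card_support, card_support]
  simp only [Fintype.sum_sum_type, extend, ne_eq, not_true, if_false, Finset.sum_const_zero,
    add_zero]
  refine Finset.sum_congr rfl fun x _ => Finset.sum_congr rfl fun y _ => ?_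
  congr

/-- The cycle `cycleGraph l`. -/
def cycleMat (l : ℕ) (i j : Fin l) : ZMod 2 := if (cycleGraph l).Adj i j then 1 else 0

section Cycle

variable {n : ℕ}

theorem cycleGraph_adj_iff (i j : Fin (n + 3)) :
    (cycleGraph (n + 3)).Adj i j ↔ j = i + 1 ∨ j = i - 1 := by
  rw [cycleGraph_adj, sub_eq_iff_eq_add, sub_eq_iff_eq_add, eq_sub_iff_add_eq, add_comm 1 j,
    add_comm 1 i, or_comm]
  simp only [eq_comm]

theorem add_one_ne_sub_one (i : Fin (n + 3)) : i + 1 ≠ i - 1 := by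
  rw [Ne, eq_sub_iff_add_eq, add_assoc, add_eq_left]
  have : 2 % (n + 3) = 2 := Nat.mod_eq_of_lt (by omega)
  simp [Fin.ext_iff, Fin.val_add, this]

theorem cycleMat_mem : cycleMat (n + 3) ∈ cycleSpace (cycleGraph (n + 3)) := by
  refine ⟨fun i j => ?_, fun i j h => ?_, fun i => ?_⟩
  · simp only [cycleMat, adj_comm]
  · by_contra h'
    exact h (if_neg h')
  · refine sum_eq_zero_of_two (add_one_ne_sub_one i) fun z => ?_
    simp only [cycleMat, cycleGraph_adj_iff]
    congr

theorem exists_eq_smul_cycleMat {f : Fin (n + 3) → Fin (n + 3) → ZMod 2}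
    (hf : f ∈ cycleSpace (cycleGraph (n + 3))) : ∃ γ : ZMod 2, f = γ • cycleMat (n + 3) := by
  have h1 : ∀ i : Fin (n + 3), f (i + 1) (i + 1 + 1) = f i (i + 1) := by
    intro i
    rw [eq_of_two_neighbors hf (add_one_ne_sub_one (i + 1)) fun z hz => (cycleGraph_adj_iff _ z).1 hz,
      add_sub_cancel_right, symm_of_mem hf]
  have h2 : ∀ i : Fin (n + 3), f i (i + 1) = f 0 1 := by
    intro i
    induction i using Fin.induction with
    | zero => simp
    | succ i ih => rw [← Fin.coeSucc_eq_succ, h1, ih]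
  refine ⟨f 0 1, ?_⟩
  funext i j
  simp only [Pi.smul_apply, cycleMat, smul_eq_mul, mul_ite, mul_one, mul_zero]
  split_ifs with h
  · rcases (cycleGraph_adj_iff i j).1 h with rfl | rfl
    · exact h2 i
    · rw [symm_of_mem hf, ← h2 (i - 1), sub_add_cancel]
  · exact eq_zero_of_mem hf h

/-- Ordered pairs are counted, hence the factor 2, as in the field `card` of `IsFrame`. -/
theorem card_support_cycleMat :
    (Finset.univ.filter fun e : Fin (n + 3) × Fin (n + 3) =>
      cycleMat (n + 3) e.1 e.2 ≠ 0).card = 2 * (n + 3) := by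
  rw [card_support]
  have : ∀ i j : Fin (n + 3), cycleMat (n + 3) i j ≠ 0 ↔ j ∈ ({i + 1, i - 1} : Finset _) := by
    intro i j
    rw [cycleMat, Finset.mem_insert, Finset.mem_singleton, ← cycleGraph_adj_iff]
    split_ifs with h <;> simp [h]
  simp only [this, ← Finset.card_filter, Finset.filter_univ_mem,
    Finset.card_pair (add_one_ne_sub_one _)]
  simp [mul_comm]

end Cycle

end Dogs

-- The first two triples are the coordinates of the ears of a hypothetical frame, and `α`, `β` are
-- the ear coordinates of its snout. If `α = 1`, neither of its ears may involve `A₁`, as it would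
-- share both `aa'` and `bb'` with the snout; but any two nonzero elements of the span of `A₂` and
-- `S` meet, so the ears are not disjoint. The case `β = 1` is symmetric.
set_option synthInstance.maxSize 2000 in
set_option synthInstance.maxHeartbeats 400000 in
set_option maxRecDepth 100000 in
theorem zmod_two_coefficients : ∀ α₁ β₁ γ₁ α₂ β₂ γ₂ α β : ZMod 2,
    ¬ (α₁ = 0 ∧ β₁ = 0 ∧ γ₁ = 0) → ¬ (α₂ = 0 ∧ β₂ = 0 ∧ γ₂ = 0) →
    (α₁ + γ₁) * (α₂ + γ₂) = 0 → (β₁ + γ₁) * (β₂ + γ₂) = 0 → γ₁ * γ₂ = 0 →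
    α₁ * α₂ = 0 → β₁ * β₂ = 0 → α₁ * α * (α₁ * α) = 0 → α₂ * α * (α₂ * α) = 0 →
    β₁ * β * (β₁ * β) = 0 → β₂ * β * (β₂ * β) = 0 → α = 0 ∧ β = 0 := by
  decide

/-! ### The long dog is a frame; the short dog is not trapped. -/

noncomputable section Dogs

set_option linter.unusedSectionVars false

open scoped Classical

variable {V : Type*} [Fintype V]

/-- A graph whose cycle space is generated as that of a dog with a snout of length less than `L`,
the edges `ab`, `bc`, `cd` being on the snout and `aa'`, `bb'`, `cc'`, `dd'` on the ears, is not
trapped. -/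
theorem not_isTrapped {G : SimpleGraph V} {L : ℕ} {A₁ A₂ S : V → V → ZMod 2}
    (h₁ : A₁ ∈ cycleSpace G) (h₂ : A₂ ∈ cycleSpace G) (hS : S ∈ cycleSpace G)
    (hspan : ∀ f ∈ cycleSpace G, ∃ α β γ : ZMod 2, f = α • A₁ + β • A₂ + γ • S)
    (hcard : (Finset.univ.filter fun e : V × V => S e.1 e.2 ≠ 0).card < 2 * L)
    {a b c d a' b' c' d' : V} (ha : s(a, a') ≠ s(b, b')) (hc : s(c, c') ≠ s(d, d'))
    (v₁ : A₁ a b = 1 ∧ A₂ a b = 0 ∧ S a b = 1) (v₂ : A₁ c d = 0 ∧ A₂ c d = 1 ∧ S c d = 1)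
    (v₃ : A₁ b c = 0 ∧ A₂ b c = 0 ∧ S b c = 1)
    (va : A₁ a a' = 1 ∧ A₂ a a' = 0 ∧ S a a' = 0) (vb : A₁ b b' = 1 ∧ A₂ b b' = 0 ∧ S b b' = 0)
    (vc : A₁ c c' = 0 ∧ A₂ c c' = 1 ∧ S c c' = 0) (vd : A₁ d d' = 0 ∧ A₂ d d' = 1 ∧ S d d' = 0) :
    ¬ IsTrapped G L := by
  obtain ⟨v₁, w₁, z₁⟩ := v₁
  obtain ⟨v₂, w₂, z₂⟩ := v₂
  obtain ⟨v₃, w₃, z₃⟩ := v₃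
  obtain ⟨va, wa, za⟩ := va
  obtain ⟨vb, wb, zb⟩ := vb
  obtain ⟨vc, wc, zc⟩ := vc
  obtain ⟨vd, wd, zd⟩ := vd
  rintro (h | ⟨-, x, hx, hx0, hxb⟩ | ⟨B₁, B₂, T, hF⟩)
  · have hli : LinearIndependent (ZMod 2) ![A₁, A₂, S] := by
      rw [Fintype.linearIndependent_iff]
      intro g hg
      rw [Fin.sum_univ_three] at hg
      have e₁ := congrFun (congrFun hg a) a'
      have e₂ := congrFun (congrFun hg c) c'
      have e₃ := congrFun (congrFun hg b) c
      simp [va, wa, za] at e₁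
      simp [vc, wc, zc] at e₂
      simp [v₃, w₃, z₃] at e₃
      intro i
      fin_cases i <;> assumption
    have h3 := finrank_span_eq_card hli
    have hle : Submodule.span (ZMod 2) (Set.range ![A₁, A₂, S]) ≤ cycleSpace G := by
      rw [Submodule.span_le]
      rintro _ ⟨i, rfl⟩
      fin_cases i
      · exact h₁
      · exact h₂
      · exact hS
    have h4 := Submodule.finrank_mono hle
    rw [h3, Fintype.card_fin] at h4
    omega
  · obtain ⟨α, β, γ, rfl⟩ := hspan x hx
    have ev : ∀ {f g : V → V → ZMod 2}, f = g → ∀ x y, f x y = g x y := by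
      rintro f _ rfl x y; rfl
    -- A block disjoint from `S` has all coordinates zero, by the edges `bc`, `ab`, `cd`. A block
    -- inside `S` has no ear part, so it is `S` itself, which `A₁` splits: it contains `ab` but not
    -- `bc`.
    rcases hxb S hS with h | h
    · have e₁ := ev h b c
      have e₂ := ev h a b
      have e₃ := ev h c d
      simp [v₃, w₃, z₃] at e₁
      simp [v₁, w₁, z₁, e₁] at e₂
      simp [v₂, w₂, z₂, e₁] at e₃
      exact hx0 (by simp [e₁, e₂, e₃])
    · have e₁ := ev h a a'
      have e₂ := ev h c c'
      simp [va, wa, za] at e₁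
      simp [vc, wc, zc] at e₂
      obtain rfl := e₁
      obtain rfl := e₂
      have hγ : γ = 1 := (zmod_two_cases γ).resolve_left fun h0 => hx0 (by simp [h0])
      subst hγ
      rcases hxb A₁ h₁ with h | h
      · simpa [v₁, z₁] using ev h a b
      · simpa [v₃, z₃] using ev h b c
  · obtain ⟨α₁, β₁, γ₁, e₁⟩ := hspan B₁ hF.mem₁
    obtain ⟨α₂, β₂, γ₂, e₂⟩ := hspan B₂ hF.mem₂
    obtain ⟨α, β, γ, e⟩ := hspan T hF.memS
    have hz : ∀ x y, B₁ x y * B₂ x y = 0 := fun x y => by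
      rw [← Pi.mul_apply, ← Pi.mul_apply, hF.mul_ears]; rfl
    have f₁ := hz a b
    have f₂ := hz c d
    have f₃ := hz b c
    have fa := hz a a'
    have fc := hz c c'
    have single : ∀ {B : V → V → ZMod 2}, (∃ p q, B * T = edgeMat p q) → ∀ {x x' y y' : V},
        s(x, x') ≠ s(y, y') → (B x x' * T x x') * (B y y' * T y y') = 0 := by
      rintro B ⟨p, q, h⟩ x x' y y' hne
      have h' : ∀ x y, B x y * T x y = edgeMat p q x y := fun x y => by rw [← h]; rfl
      rw [h', h']
      by_contra h0
      exact hne ((edgeMat_ne_zero.1 (left_ne_zero_of_mul h0)).trans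
        (edgeMat_ne_zero.1 (right_ne_zero_of_mul h0)).symm)
    have g₁ := single hF.mul₁ ha
    have g₂ := single hF.mul₂ ha
    have g₃ := single hF.mul₁ hc
    have g₄ := single hF.mul₂ hc
    have n₁ : ¬ (α₁ = 0 ∧ β₁ = 0 ∧ γ₁ = 0) := by
      rintro ⟨rfl, rfl, rfl⟩
      exact hF.ne_zero (by simp [e₁])
    have n₂ : ¬ (α₂ = 0 ∧ β₂ = 0 ∧ γ₂ = 0) := by
      rintro ⟨rfl, rfl, rfl⟩
      exact hF.symm.ne_zero (by simp [e₂])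
    simp only [e₁, e₂, e, Pi.add_apply, Pi.smul_apply, smul_eq_mul, v₁, v₂, v₃, va, vb, vc, vd, w₁,
      w₂, w₃, wa, wb, wc, wd, z₁, z₂, z₃, za, zb, zc, zd, mul_one, mul_zero, add_zero, zero_add]
      at f₁ f₂ f₃ fa fc g₁ g₂ g₃ g₄
    obtain ⟨rfl, rfl⟩ :=
      zmod_two_coefficients _ _ _ _ _ _ _ _ n₁ n₂ f₁ f₂ f₃ fa fc g₁ g₂ g₃ g₄
    -- Now the snout of the frame is a multiple of `S`, whose support is too small.
    refine absurd (hF.card.trans (Finset.card_le_card fun p hp => ?_)) (not_le.2 hcard)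
    simp only [Finset.mem_filter, Finset.mem_univ, true_and] at hp ⊢
    intro h0
    apply hp
    simp [e, h0]

/-- The first ear of a dog. -/
def dogEar₁ (l l₁ l₂ : ℕ) (h : 4 ≤ l) :
    (Fin l ⊕ Fin (l₁ - 2)) ⊕ Fin (l₂ - 2) → (Fin l ⊕ Fin (l₁ - 2)) ⊕ Fin (l₂ - 2) → ZMod 2 :=
  extend (earMat ⟨0, by omega⟩ ⟨1, by omega⟩ l₁)

/-- The second ear of a dog. -/
def dogEar₂ (l l₁ l₂ : ℕ) (h : 4 ≤ l) :
    (Fin l ⊕ Fin (l₁ - 2)) ⊕ Fin (l₂ - 2) → (Fin l ⊕ Fin (l₁ - 2)) ⊕ Fin (l₂ - 2) → ZMod 2 :=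
  earMat (.inl ⟨2, by omega⟩) (.inl ⟨3, by omega⟩) l₂

/-- The snout of a dog. -/
def dogSnout (l l₁ l₂ : ℕ) :
    (Fin l ⊕ Fin (l₁ - 2)) ⊕ Fin (l₂ - 2) → (Fin l ⊕ Fin (l₁ - 2)) ⊕ Fin (l₂ - 2) → ZMod 2 :=
  extend (extend (cycleMat l))

section Dog

variable {l l₁ l₂ : ℕ}

theorem cycleGraph_adj_val {l : ℕ} (hl : 3 ≤ l) (i j : Fin l) : (cycleGraph l).Adj i j ↔
    i.val + 1 = j.val ∨ j.val + 1 = i.val ∨ (i.val = 0 ∧ j.val + 1 = l) ∨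
      (j.val = 0 ∧ i.val + 1 = l) := by
  have hi := i.2
  have hj := j.2
  rw [cycleGraph_adj']
  rcases le_or_gt i j with h | h
  · rw [Fin.sub_val_of_le h]
    rcases h.eq_or_lt with rfl | h'
    · simp [Fin.sub_val_of_le le_rfl]; omega
    · rw [Fin.coe_sub_iff_lt.2 h']
      have := Fin.lt_def.1 h'
      omega
  · rw [Fin.sub_val_of_le h.le, Fin.coe_sub_iff_lt.2 h]
    have := Fin.lt_def.1 h
    omega

theorem cycleMat_symm (i j : Fin l) : cycleMat l i j = cycleMat l j i := by
  simp only [cycleMat, adj_comm]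

theorem cycleMat_of_succ {l : ℕ} (hl : 3 ≤ l) {i : ℕ} (hi : i + 1 < l) :
    cycleMat l ⟨i, by omega⟩ ⟨i + 1, hi⟩ = 1 := by
  rw [cycleMat, if_pos]
  rw [cycleGraph_adj_val hl]
  simp

theorem dogSnout_mem (h : 4 ≤ l) : dogSnout l l₁ l₂ ∈ cycleSpace (dog l l₁ l₂ h) := by
  obtain ⟨n, rfl⟩ : ∃ n, l = n + 3 := ⟨l - 3, by omega⟩
  exact extend_mem (extend_mem cycleMat_mem)

theorem adj_zero_one (h : 4 ≤ l) : (cycleGraph l).Adj ⟨0, by omega⟩ ⟨1, by omega⟩ := by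
  rw [cycleGraph_adj_val (by omega)]; simp

theorem adj_two_three (h : 4 ≤ l) :
    (attachEar (cycleGraph l) ⟨0, by omega⟩ ⟨1, by omega⟩ l₁).Adj
      (.inl ⟨2, by omega⟩) (.inl ⟨3, by omega⟩) := by
  change (cycleGraph l).Adj _ _
  rw [cycleGraph_adj_val (by omega)]; simp

theorem dogEar₁_mem (h : 4 ≤ l) (h₁ : 3 ≤ l₁) :
    dogEar₁ l l₁ l₂ h ∈ cycleSpace (dog l l₁ l₂ h) :=
  extend_mem (earMat_mem (adj_zero_one h) h₁)

theorem dogEar₂_mem (h : 4 ≤ l) (h₂ : 3 ≤ l₂) :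
    dogEar₂ l l₁ l₂ h ∈ cycleSpace (dog l l₁ l₂ h) :=
  earMat_mem (adj_two_three h) h₂

theorem extend_add_smul {ι : Type*} (f g : V → V → ZMod 2) (c : ZMod 2) :
    (extend (f + c • g) : V ⊕ ι → V ⊕ ι → ZMod 2) = extend f + c • extend g := by
  funext z z'
  rcases z with a | i <;> rcases z' with b | j <;> simp [extend]

theorem extend_smul {ι : Type*} (g : V → V → ZMod 2) (c : ZMod 2) :
    (extend (c • g) : V ⊕ ι → V ⊕ ι → ZMod 2) = c • extend g := by
  funext z z'
  rcases z with a | i <;> rcases z' with b | j <;> simp [extend]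

theorem dog_span (h : 4 ≤ l) (h₁ : 3 ≤ l₁) (h₂ : 3 ≤ l₂) : ∀ f ∈ cycleSpace (dog l l₁ l₂ h),
    ∃ α β γ : ZMod 2,
      f = α • dogEar₁ l l₁ l₂ h + β • dogEar₂ l l₁ l₂ h + γ • dogSnout l l₁ l₂ := by
  intro f hf
  obtain ⟨β, g, hg, rfl⟩ := exists_eq_extend_add (adj_two_three h) h₂ hf
  obtain ⟨α, k, hk, rfl⟩ := exists_eq_extend_add (adj_zero_one h) h₁ hg
  obtain ⟨n, rfl⟩ : ∃ n, l = n + 3 := ⟨l - 3, by omega⟩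
  obtain ⟨γ, rfl⟩ := exists_eq_smul_cycleMat hk
  refine ⟨α, β, γ, ?_⟩
  rw [extend_add_smul, extend_smul, extend_smul]
  simp only [dogEar₁, dogEar₂, dogSnout]
  abel

theorem card_support_dogSnout (h : 4 ≤ l) :
    (Finset.univ.filter fun e : ((Fin l ⊕ Fin (l₁ - 2)) ⊕ Fin (l₂ - 2)) ×
      ((Fin l ⊕ Fin (l₁ - 2)) ⊕ Fin (l₂ - 2)) => dogSnout l l₁ l₂ e.1 e.2 ≠ 0).card = 2 * l := by
  obtain ⟨n, rfl⟩ : ∃ n, l = n + 3 := ⟨l - 3, by omega⟩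
  exact (card_support_extend _).trans ((card_support_extend _).trans card_support_cycleMat)

theorem edgeMat_mul_extend {ι : Type*} {x y : V} {A : V → V → ZMod 2} (h : A x y = 1)
    (h' : A y x = 1) :
    (extend (edgeMat x y) : V ⊕ ι → V ⊕ ι → ZMod 2) * extend A = edgeMat (.inl x) (.inl y) := by
  funext z z'
  rcases z with a | i <;> rcases z' with b | j <;> simp [extend, edgeMat]
  grind

theorem earMat_mul_extend {x y : V} {m : ℕ} (A : V → V → ZMod 2) :
    earMat x y m * extend A = extend (edgeMat x y) * extend A := by
  funext z z'
  rcases z with a | i <;> rcases z' with b | j <;> simp [extend, earMat]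

theorem extend_mul {ι : Type*} (A B : V → V → ZMod 2) :
    (extend A : V ⊕ ι → V ⊕ ι → ZMod 2) * extend B = extend (A * B) := by
  funext z z'
  rcases z with a | i <;> rcases z' with b | j <;> simp [extend]

theorem extend_edgeMat {ι : Type*} (x y : V) :
    (extend (edgeMat x y) : V ⊕ ι → V ⊕ ι → ZMod 2) = edgeMat (.inl x) (.inl y) := by
  funext z z'
  rcases z with a | i <;> rcases z' with b | j <;> simp [extend, edgeMat]

theorem isFrame_dog (h : 4 ≤ l) (h₁ : 3 ≤ l₁) (h₂ : 3 ≤ l₂) :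
    IsFrame (dog l l₁ l₂ h) l (dogEar₁ l l₁ l₂ h) (dogEar₂ l l₁ l₂ h) (dogSnout l l₁ l₂) where
  mem₁ := dogEar₁_mem h h₁
  mem₂ := dogEar₂_mem h h₂
  memS := dogSnout_mem h
  mul_ears := by
    rw [mul_comm, dogEar₂, dogEar₁, earMat_mul_extend, extend_mul]
    funext z z'
    rcases z with (a | i) | i <;> rcases z' with (b | j) | j <;> simp [extend, edgeMat, earMat]
    grind
  mul₁ := by
    refine ⟨.inl (.inl ⟨0, by omega⟩), .inl (.inl ⟨1, by omega⟩), ?_⟩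
    have h1 := cycleMat_of_succ (l := l) (by omega) (i := 0) (by omega)
    have h2 : cycleMat l ⟨1, by omega⟩ ⟨0, by omega⟩ = 1 := by
      rw [cycleMat_symm]; exact h1
    rw [dogEar₁, dogSnout, extend_mul, earMat_mul_extend, edgeMat_mul_extend h1 h2, extend_edgeMat]
  mul₂ := by
    refine ⟨.inl (.inl ⟨2, by omega⟩), .inl (.inl ⟨3, by omega⟩), ?_⟩
    have h1 := cycleMat_of_succ (l := l) (by omega) (i := 2) (by omega)
    have h2 : cycleMat l ⟨3, by omega⟩ ⟨2, by omega⟩ = 1 := by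
      rw [cycleMat_symm]; exact h1
    rw [dogEar₂, dogSnout, earMat_mul_extend, edgeMat_mul_extend]
    · exact h1
    · exact h2
  card := (card_support_dogSnout h).ge
  span := dog_span h h₁ h₂

theorem not_isTrapped_dog (h : 4 ≤ l) (h₁ : 3 ≤ l₁) (h₂ : 3 ≤ l₂) {L : ℕ} (hL : l < L) :
    ¬ IsTrapped (dog l l₁ l₂ h) L := by
  have c₀ := cycleMat_of_succ (l := l) (by omega) (i := 0) (by omega)
  have c₁ := cycleMat_of_succ (l := l) (by omega) (i := 1) (by omega)
  have c₂ := cycleMat_of_succ (l := l) (by omega) (i := 2) (by omega)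
  have e₁ : l₁ - 3 + 1 = l₁ - 2 := by omega
  have e₂ : l₂ - 3 + 1 = l₂ - 2 := by omega
  refine not_isTrapped (dogEar₁_mem h h₁) (dogEar₂_mem h h₂) (dogSnout_mem h) (dog_span h h₁ h₂)
    (by rw [card_support_dogSnout h]; omega)
    (a := .inl (.inl ⟨0, by omega⟩)) (b := .inl (.inl ⟨1, by omega⟩))
    (c := .inl (.inl ⟨2, by omega⟩)) (d := .inl (.inl ⟨3, by omega⟩))
    -- These are the first and last new vertices of each ear. They coincide when the ear is a
    -- triangle, but the edges leading to them remain distinct.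
    (a' := .inl (.inr ⟨0, by omega⟩)) (b' := .inl (.inr ⟨l₁ - 3, by omega⟩))
    (c' := .inr ⟨0, by omega⟩) (d' := .inr ⟨l₂ - 3, by omega⟩)
    (by simp) (by simp) ?_ ?_ ?_ ?_ ?_ ?_ ?_
  · simp [dogEar₁, dogEar₂, dogSnout, extend, earMat, edgeMat, c₀]
  · simp [dogEar₁, dogEar₂, dogSnout, extend, earMat, edgeMat, c₂]
  · simp [dogEar₁, dogEar₂, dogSnout, extend, earMat, edgeMat, c₁]
  · simp [dogEar₁, dogEar₂, dogSnout, extend, earMat, edgeMat]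
  · simp [dogEar₁, dogEar₂, dogSnout, extend, earMat, edgeMat, e₁]
  · simp [dogEar₁, dogEar₂, dogSnout, extend, earMat]
  · simp [dogEar₁, dogEar₂, dogSnout, extend, earMat, e₂]

theorem not_isBipartiteMinor_dog {k : ℕ} (h : 4 ≤ l) (h' : 4 ≤ l + k) (h₁ : 3 ≤ l₁) (h₂ : 3 ≤ l₂)
    (hk : 1 ≤ k) : ¬ IsBipartiteMinor (dog l l₁ l₂ h) (dog (l + k) l₁ l₂ h') := by
  intro hm
  obtain ⟨inst, ht⟩ := IsTrapped.of_isBipartiteMinor (L := l + k) hm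
    ⟨inferInstance, Or.inr (Or.inr ⟨_, _, _, isFrame_dog h' h₁ h₂⟩)⟩
  obtain rfl : inst = instFintypeSum _ _ := Subsingleton.elim _ _
  exact not_isTrapped_dog (L := l + k) h h₁ h₂ (by omega) ht

end Dog

end Dogs

/-! ### The short dog as a minor of the long one. -/

section Minor

/-- A map to `G` that meets every vertex outside `{u, v}` and only `u` among these two, once each,
and that reflects the adjacency of the contraction, exhibits an edge contraction. -/
theorem isEdgeContraction_of_map {V W : Type*} {G : SimpleGraph V} {H : SimpleGraph W} {u v : V}
    (huv : G.Adj u v) {σ : W → V} (hσ : Function.Injective σ) (hv : ∀ a, σ a ≠ v)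
    (hsurj : ∀ x, x ≠ v → ∃ a, σ a = x)
    (hadj : ∀ a b, σ a ≠ u → σ b ≠ u → (H.Adj a b ↔ G.Adj (σ a) (σ b)))
    (hadj' : ∀ a b, σ a = u → σ b ≠ u → (H.Adj a b ↔ G.Adj u (σ b) ∨ G.Adj v (σ b))) :
    Nonempty (H ≃g contract G {u, v}) := by
  classical
  have hmem : ∀ a, σ a ∈ ({u, v} : Set V) ↔ σ a = u := fun a => by simp [hv a]
  have hbij : Function.Bijective fun a => contractMap {u, v} (σ a) := by
    constructor
    · intro a b hab
      apply hσ
      simp only at hab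
      rcases hb : contractMap {u, v} (σ b) with _ | z
      · rw [hb, contractMap_eq_none, hmem] at hab
        rw [contractMap_eq_none, hmem] at hb
        rw [hab, hb]
      · rw [hb, contractMap_eq_some] at hab
        rw [contractMap_eq_some] at hb
        rw [hab, hb]
    · rintro (_ | ⟨x, hx⟩)
      · obtain ⟨a, ha⟩ := hsurj u huv.ne
        exact ⟨a, contractMap_eq_none.2 (by simp [ha])⟩
      · obtain ⟨a, ha⟩ := hsurj x (fun h => hx (by simp [h]))
        exact ⟨a, contractMap_eq_some.2 ha⟩
  have hsome : ∀ a (h : σ a ≠ u),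
      contractMap {u, v} (σ a) = some ⟨σ a, fun h' => h ((hmem a).1 h')⟩ :=
    fun a h => contractMap_eq_some.2 rfl
  have hnone : ∀ a, σ a = u → contractMap {u, v} (σ a) = none :=
    fun a h => contractMap_eq_none.2 ((hmem a).2 h)
  refine ⟨⟨Equiv.ofBijective _ hbij, ?_⟩⟩
  intro a b
  simp only [Equiv.ofBijective_apply]
  by_cases ha : σ a = u <;> by_cases hb : σ b = u
  · obtain rfl : a = b := hσ (ha.trans hb.symm)
    simp
  · rw [hnone a ha, hsome b hb, hadj' a b ha hb]
    simp [contract]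
  · rw [hsome a ha, hnone b hb, adj_comm H, hadj' b a hb ha]
    simp [contract]
  · rw [hsome a ha, hsome b hb, hadj a b ha hb]
    simp [contract]

/-- The contracted edge joins the last two snout vertices `l - 1` and `l`. Both lie beyond the
vertices `0, 1, 2, 3` carrying the ears, so only the snout changes. -/
theorem isEdgeContraction_dog {l l₁ l₂ : ℕ} (hl : 5 ≤ l) :
    IsEdgeContraction (dog l l₁ l₂ (by omega)) (dog (l + 1) l₁ l₂ (by omega)) := by
  have h3 : 3 ≤ l := by omega
  have h3' : 3 ≤ l + 1 := by omega
  refine ⟨.inl (.inl ⟨l - 1, by omega⟩), .inl (.inl ⟨l, by omega⟩), ?_,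
    isEdgeContraction_of_map ?_ (σ := Sum.map (Sum.map Fin.castSucc id) id) ?_ ?_ ?_ ?_ ?_⟩
  · change (cycleGraph (l + 1)).Adj _ _
    rw [cycleGraph_adj_val (by omega)]
    simp; omega
  · change (cycleGraph (l + 1)).Adj _ _
    rw [cycleGraph_adj_val (by omega)]
    simp; omega
  · exact ((Fin.castSucc_injective l).sumMap Function.injective_id).sumMap Function.injective_id
  · rintro ((i | i) | i) <;> simp [Fin.ext_iff]
    exact i.2.ne
  · rintro ((i | i) | i) h
    · refine ⟨.inl (.inl ⟨i.val, ?_⟩), rfl⟩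
      have : i.val ≠ l := fun h' => h (by simp [Fin.ext_iff, h'])
      omega
    · exact ⟨.inl (.inr i), rfl⟩
    · exact ⟨.inr i, rfl⟩
  · rintro ((i | i) | i) ((j | j) | j) hi hj <;>
      simp only [dog, attachEar, Sum.map_inl, Sum.map_inr, id_eq, ne_eq, Sum.inl.injEq, Fin.ext_iff,
        Fin.val_castSucc, reduceCtorEq, false_and, or_self,
        cycleGraph_adj_val h3, cycleGraph_adj_val h3'] at hi hj ⊢
    omega
  · rintro ((i | i) | i) ((j | j) | j) hi hj <;>
      simp only [dog, attachEar, Sum.map_inl, Sum.map_inr, id_eq, ne_eq, Sum.inl.injEq, Fin.ext_iff,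
        Fin.val_castSucc, reduceCtorEq,
        and_true, cycleGraph_adj_val h3, cycleGraph_adj_val h3'] at hi hj ⊢ <;> omega

theorem isMinor_dog {l l₁ l₂ : ℕ} (hl : 5 ≤ l) (k : ℕ) :
    IsMinor (dog l l₁ l₂ (by omega)) (dog (l + k) l₁ l₂ (by omega)) := by
  induction k with
  | zero => exact .iso ⟨Iso.refl⟩
  | succ k ih => exact .step (Or.inr (Or.inr (isEdgeContraction_dog (l := l + k) (by omega)))) ih

end Minor

end BipartiteMinors

theorem mainTheorem2 (l l₁ l₂ k : ℕ) (hl : 5 ≤ l) (hl₁ : 3 ≤ l₁) (hl₂ : 3 ≤ l₂) (hk : 1 ≤ k) :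
    BipartiteMinors.IsMinor
        (BipartiteMinors.dog l l₁ l₂ (le_trans (by norm_num) hl))
        (BipartiteMinors.dog (l + k) l₁ l₂ (le_trans (le_trans (by norm_num) hl)
          (Nat.le_add_right l k))) ∧
      ¬ BipartiteMinors.IsBipartiteMinor
        (BipartiteMinors.dog l l₁ l₂ (le_trans (by norm_num) hl))
        (BipartiteMinors.dog (l + k) l₁ l₂ (le_trans (le_trans (by norm_num) hl)
          (Nat.le_add_right l k))) :=
  ⟨BipartiteMinors.isMinor_dog hl k,
    BipartiteMinors.not_isBipartiteMinor_dog _ _ hl₁ hl₂ hk⟩
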